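/- Let $P$ be a simple $d$-polytope with graph $G(P)$ (vertices and edges of $P$; simple means that every vertex lies on exactly $d$ edges), and let $2\le k\le d-1$. Let $V_k(P)$ be the set of vertex sets of the $k$-faces of $P$. A $k$-frame is a subgraph of $G(P)$ isomorphic to the star $K_{1,k}$. A set $\mathcal S$ of nonempty subsets of the vertex set of $P$ is a $k$-system of $G(P)$ if every $S\in\mathcal S$ induces a $k$-regular subgraph of $G(P)$ and the node set of every $k$-frame is contained in a unique member of $\mathcal S$. For an acyclic orientation $\mathcal O$ of $G(P)$ let $h_i(\mathcal O)$ be the number of vertices with exactly $i$ incident edges directed inwards, and $H_k(\mathcal O)=\sum_{i=0}^d h_i(\mathcal O)\binom ik$. (a) Let $\mathcal S$ be a $k$-system of $G(P)$. Then either there is an acyclic orientation $\mathcal O$ of $G(P)$ with $H_k(\mathcal O)=|\mathcal S|$, or there is a $k$-system $\mathcal S'$ of $G(P)$ with $|\mathcal S'|>|\mathcal S|$. In the first case $\mathcal S=V_k(P)$; in the second case $\mathcal S\ne V_k(P)$ (so the two cases exclude each other). (b) This gives a good characterization of $V_k(P)$ among all sets $\mathcal S$ of subsets of the vertex set of $P$: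 both answers to the question "Is $\mathcal S=V_k(P)$?" have certificates of polynomial size that can be checked in polynomial time. Precisely, encode $(G(P),k,\mathcal S)$, for any numbering of the vertices and any listing of $\mathcal S$ without repetition, as a word $x$ consisting of the adjacency matrix of $G(P)$, the number $k$ in unary and the incidence vectors of the members of $\mathcal S$. There are two polynomial-time verifiers $A_{\mathrm{yes}}$, $A_{\mathrm{no}}$ and a polynomial $f$, independent of $d$, $k$, $P$ and $\mathcal S$, such that for every simple $d$-polytope $P$ with $n$ vertices, every $k$ with $2\le k\le d-1$ and every set $\mathcal S$ of subsets of its vertex set (with encoding $x$): if $\mathcal S=V_k(P)$, then $A_{\mathrm{yes}}$ accepts $(x,c)$ for some certificate $c$ of size at most $f(n)$, and otherwise $A_{\mathrm{yes}}$ accepts $(x,c)$ for no $c$; if $\mathcal S\neq V_k(P)$, then $A_{\mathrm{no}}$ accepts $(x,c)$ for some certificate $c$ of size at most $f(|x|)$, and even at most $f(n)$ if $k=d-1$, and otherwise $A_{\mathrm{no}}$ accepts $(x,c)$ for no $c$. -/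

import Mathlib

noncomputable section

open scoped Classical

namespace KSys

/-! ### Combinatorics of finite graphs -/

section Graph

variable {V : Type*} [Fintype V]

/-- The number of neighbours of `v` that lie in `S`. For `v ∈ S` this is the degree of `v` in the
subgraph of `G` induced by `S`; for `S = univ` it is the degree of `v` in `G`. -/
def degIn (G : SimpleGraph V) (S : Finset V) (v : V) : ℕ :=
  (S.filter fun w => G.Adj v w).card

/-- A `k`-frame of `G` (a subgraph isomorphic to the star `K_{1,k}`), given by its root `v` and the
set `T` of its `k` leaves, all of them neighbours of `v`. Its node set is `insert v T`. -/
def IsFrame (G : SimpleGraph V) (k : ℕ) (v : V) (T : Finset V) : Prop :=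
  T.card = k ∧ ∀ w ∈ T, G.Adj v w

/-- A set `𝒮` of (nonempty) vertex sets is a `k`-system of `G` if each of its members induces a
`k`-regular subgraph and the node set of every `k`-frame is contained in a unique member. -/
def IsKSystem (G : SimpleGraph V) (k : ℕ) (𝒮 : Finset (Finset V)) : Prop :=
  (∀ S ∈ 𝒮, S.Nonempty ∧ ∀ v ∈ S, degIn G S v = k) ∧
  ∀ v T, IsFrame G k v T → ∃! S, S ∈ 𝒮 ∧ insert v T ⊆ S

/-- An orientation of a graph: each edge `uv` is directed in exactly one of its two directions
(`dir u v` means that `uv` is directed from `u` to `v`). -/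
structure GraphOrientation (G : SimpleGraph V) where
  dir : V → V → Prop
  adj_iff : ∀ u v, G.Adj u v ↔ dir u v ∨ dir v u
  asymm : ∀ u v, dir u v → ¬ dir v u

variable {G : SimpleGraph V}

/-- There is no directed cycle. -/
def GraphOrientation.IsAcyclic (O : GraphOrientation G) : Prop :=
  ∀ v, ¬ Relation.TransGen O.dir v v

/-- The number of edges at `v` that are directed towards `v`. -/
def GraphOrientation.inDeg (O : GraphOrientation G) (v : V) : ℕ :=
  (Finset.univ.filter fun u => O.dir u v).card

/-- `h_i(O)`: the number of vertices with precisely `i` of their incident edges directed inwards. -/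
def GraphOrientation.h (O : GraphOrientation G) (i : ℕ) : ℕ :=
  (Finset.univ.filter fun v => O.inDeg v = i).card

/-- `H_k(O) = ∑_{i=0}^d h_i(O) * (i choose k)`. -/
def GraphOrientation.H (O : GraphOrientation G) (d k : ℕ) : ℕ :=
  ∑ i ∈ Finset.range (d + 1), O.h i * i.choose k

end Graph

/-! ### Convex polytopes, their faces and their graphs -/

/-- A (nonempty convex) polytope in `ℝ^m`: the convex hull of a finite nonempty set of points. -/
structure Polytope (m : ℕ) where
  carrier : Set (EuclideanSpace ℝ (Fin m))
  exists_finset : ∃ T : Finset (EuclideanSpace ℝ (Fin m)),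
    T.Nonempty ∧ carrier = convexHull ℝ (T : Set (EuclideanSpace ℝ (Fin m)))

namespace Polytope

variable {m : ℕ} (P : Polytope m)

/-- The dimension of the affine hull of `P`. -/
def dim : ℕ := Module.finrank ℝ (vectorSpan ℝ P.carrier)

/-- `F` is a `k`-dimensional (nonempty) face of `P`, i.e. the set of maximizers over `P` of some
linear function, with affine hull of dimension `k`. -/
def IsFace (k : ℕ) (F : Set (EuclideanSpace ℝ (Fin m))) : Prop :=
  F.Nonempty ∧ IsExposed ℝ P.carrier F ∧ Module.finrank ℝ (vectorSpan ℝ F) = k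

/-- The vertices of `P`: the points `x` such that `{x}` is a face of `P`. -/
abbrev Vert : Type := {x : EuclideanSpace ℝ (Fin m) // IsExposed ℝ P.carrier {x}}

theorem finite_vert : Finite P.Vert := by
  obtain ⟨T, -, hT⟩ := P.exists_finset
  refine Set.Finite.subset T.finite_toSet (fun x hx => ?_)
  have h := exposedPoints_subset_extremePoints (mem_exposedPoints_iff_exposed_singleton.2 hx)
  rw [hT] at h
  exact extremePoints_convexHull_subset h

instance : Fintype P.Vert := @Fintype.ofFinite _ P.finite_vert

/-- The vertex-edge graph of `P`: two distinct vertices are adjacent if the segment between them is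
a `1`-face. -/
def graph : SimpleGraph P.Vert where
  Adj u v := u ≠ v ∧ P.IsFace 1 (segment ℝ u.1 v.1)
  symm := ⟨fun _ _ h => ⟨h.1.symm, by rw [segment_symm]; exact h.2⟩⟩
  loopless := ⟨fun _ h => h.1 rfl⟩

/-- `P` is simple: every vertex is incident with exactly `dim P` edges. -/
def IsSimple : Prop := ∀ v, degIn P.graph Finset.univ v = P.dim

/-- The set of vertex sets of `k`-faces of `P`. -/
def faceVerts (k : ℕ) : Finset (Finset P.Vert) :=
  Finset.univ.filter fun W => ∃ F, P.IsFace k F ∧ ∀ v : P.Vert, v ∈ W ↔ v.1 ∈ F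

end Polytope

/-! ### A machine model with a step count

Programs over binary trees in the style of the textbook language WHILE: the only data are
binary trees, built from the atom `nil` by `cons`; a program has a single input and a single
output, and every elementary operation manipulates a bounded number of pointers and costs one step.
The decision problems solved in polynomially many steps are those of the usual class P. -/

/-- Binary trees. -/
inductive Data : Type
  | nil : Data
  | cons : Data → Data → Data

namespace Data

/-- The number of nodes. -/
def size : Data → ℕ
  | nil => 1
  | cons a b => a.size + b.size + 1

def head : Data → Data
  | nil => nil
  | cons a _ => a

def tail : Data → Data
  | nil => nil
  | cons _ b => b

/-- `[a₁, …, aᵣ]` is stored as `cons a₁ (cons a₂ (… nil))`. -/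
def ofList : List Data → Data
  | [] => nil
  | a :: l => cons a (ofList l)

/-- The truth value of a proposition, as `nil` (false) or `cons nil nil` (true). -/
def ofProp (p : Prop) : Data := if p then cons nil nil else nil

/-- Numbers are stored in unary. -/
def ofNat (n : ℕ) : Data := ofList (List.replicate n nil)

end Data

inductive Prog : Type
  | skip : Prog
  | nil : Prog
  | head : Prog
  | tail : Prog
  | pair : Prog → Prog → Prog
  | seq : Prog → Prog → Prog
  | ite : Prog → Prog → Prog → Prog
  | loop : Prog → Prog → Prog

/-- `Run p x y t`: on input `x`, program `p` halts with output `y` after exactly `t` steps. Here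
`pair p q` runs `p` and `q` on the same input and conses the two outputs, `seq p q` runs `p` and
then `q`, `ite b p q` is `if b then p else q`, and `loop b p` is `while b do p`, where the output
`nil` of the test `b` counts as false and every other output as true. -/
inductive Run : Prog → Data → Data → ℕ → Prop
  | skip (x : Data) : Run .skip x x 1
  | nil (x : Data) : Run .nil x .nil 1
  | head (x : Data) : Run .head x x.head 1
  | tail (x : Data) : Run .tail x x.tail 1
  | pair {p q : Prog} {x y z : Data} {s t : ℕ} :
      Run p x y s → Run q x z t → Run (.pair p q) x (.cons y z) (s + t + 1)
  | seq {p q : Prog} {x y z : Data} {s t : ℕ} :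
      Run p x y s → Run q y z t → Run (.seq p q) x z (s + t + 1)
  | ite_true {b p q : Prog} {x u v y : Data} {s t : ℕ} :
      Run b x (.cons u v) s → Run p x y t → Run (.ite b p q) x y (s + t + 1)
  | ite_false {b p q : Prog} {x y : Data} {s t : ℕ} :
      Run b x .nil s → Run q x y t → Run (.ite b p q) x y (s + t + 1)
  | loop_false {b p : Prog} {x : Data} {s : ℕ} :
      Run b x .nil s → Run (.loop b p) x x (s + 1)
  | loop_true {b p : Prog} {x u v y z : Data} {s t r : ℕ} :
      Run b x (.cons u v) s → Run p x y t → Run (.loop b p) y z r →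
        Run (.loop b p) x z (s + t + r + 1)

/-- The model is deterministic: output and step count are determined by program and input. -/
theorem Run.unique {p : Prog} {x y y' : Data} {t t' : ℕ} (h : Run p x y t) (h' : Run p x y' t') :
    y = y' ∧ t = t' := by
  induction h generalizing y' t' with
  | skip x => cases h'; exact ⟨rfl, rfl⟩
  | nil x => cases h'; exact ⟨rfl, rfl⟩
  | head x => cases h'; exact ⟨rfl, rfl⟩
  | tail x => cases h'; exact ⟨rfl, rfl⟩
  | pair _ _ ih1 ih2 => cases h' with
    | pair h1 h2 => grind
  | seq _ _ ih1 ih2 => cases h' with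
    | seq h1 h2 => grind
  | ite_true _ _ ih1 ih2 => cases h' with
    | ite_true h1 h2 => grind
    | ite_false h1 h2 => grind
  | ite_false _ _ ih1 ih2 => cases h' with
    | ite_true h1 h2 => grind
    | ite_false h1 h2 => grind
  | loop_false _ ih1 => cases h' with
    | loop_false h1 => grind
    | loop_true h1 h2 h3 => grind
  | loop_true _ _ _ ih1 ih2 ih3 => cases h' with
    | loop_false h1 => grind
    | loop_true h1 h2 h3 => grind

/-- `p` halts on every input, after a number of steps that is polynomial in the size of the
input. -/
def Prog.IsPolyTime (p : Prog) : Prop :=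
  ∃ f : Polynomial ℕ, ∀ x : Data, ∃ y t, Run p x y t ∧ t ≤ f.eval x.size

/-- `p` halts on input `x` with an output different from `nil`. -/
def Prog.Accepts (p : Prog) (x : Data) : Prop :=
  ∃ y t, Run p x y t ∧ y ≠ .nil

/-- `Q`, a statement about the problem instance `x`, has certificates of size at most `B` that the
verifier `p` checks: if `Q` is true, then `p` accepts `x` together with some such certificate; if
`Q` is false, then `p` does not accept `x` together with any `c` whatsoever. -/
def Prog.Certifies (p : Prog) (B : ℕ) (x : Data) (Q : Prop) : Prop :=
  (Q → ∃ c : Data, c.size ≤ B ∧ p.Accepts (.cons x c)) ∧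
  ∀ c : Data, p.Accepts (.cons x c) → Q

/-- The input `(G, k, 𝒮)`, where the vertices of `G` are numbered by `e` and the list `L` enumerates
`𝒮`: the adjacency matrix of `G`, the number `k`, and the list of the incidence vectors of the
members of `𝒮`. -/
def encode {V : Type*} {n : ℕ} (e : Fin n ≃ V) (G : SimpleGraph V) (k : ℕ)
    (L : List (Finset V)) : Data :=
  .cons (.ofList (List.ofFn fun i => .ofList (List.ofFn fun j => .ofProp (G.Adj (e i) (e j)))))
    (.cons (.ofNat k)
      (.ofList (L.map fun S => .ofList (List.ofFn fun i => .ofProp (e i ∈ S)))))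

end KSys

end

/-! The proof counts sinks. In a `k`-system the members containing a vertex `v` correspond to the
`k`-subsets of its neighbours, so a vertex of in-degree `i` is a sink of exactly `i.choose k`
members. Summing over vertices, the members of any `k`-system have `H_k(O)` sinks in total
(`IsKSystem.sum_card_sinks`). If `O` is acyclic, every member has a sink; hence `|𝒮| ≤ H_k(O)`, with
equality iff every sink is unique (`IsKSystem.card_eq_H_iff`).

A generic linear function orients `G(P)` so that every face has one sink, because its local maxima
on a face are global. Thus `H_k(O) = |V_k(P)|` for this orientation, and no `k`-system is larger
than `V_k(P)`. If `|𝒮| = |V_k(P)|`, choose the function to be smallest on a given `k`-face `W`. The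
member of `𝒮` that contains the frame of `W` at the top vertex of `W` has that vertex as its only
sink, so it lies in `W`, and regularity makes it equal to `W`. Hence `V_k(P)` is the unique largest
`k`-system (`IsKSystem.eq_of_card_le`), which gives (a).

The geometric input is that a polytope lies in the cone spanned by its edges at any vertex
(`Polytope.sub_mem_edgeCone`). For simple polytopes these edges are linearly independent, so any `k`
of them span a unique `k`-face.

For (b), a yes-certificate is the order of the vertices under a generic linear function: it suffices
to check that no member has two sinks. A no-certificate for a `k`-system is `V_k(P)` itself;
anything else fails the `k`-system test and needs no certificate. Since `d.choose k ≤ |𝒮|` and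
`|V_k(P)| ≤ n * d.choose k`, the certificate has size polynomial in that of the input, and in `n` if
`k = d - 1`. There may be too many frames to enumerate, so the test uses closure under exchanging
one leaf instead (`IsLocalKSystem`). -/

noncomputable section

open scoped Classical

set_option linter.unusedSectionVars false

namespace KSys

/-! ### Counting sinks in `k`-systems of a finite graph -/

section Combinatorics

variable {V : Type*} [Fintype V] {G : SimpleGraph V}

/-- The neighbours of `v` that lie in `S`. -/
def nbrs (G : SimpleGraph V) (S : Finset V) (v : V) : Finset V :=
  S.filter fun w => G.Adj v w

theorem mem_nbrs {S : Finset V} {v w : V} : w ∈ nbrs G S v ↔ w ∈ S ∧ G.Adj v w := by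
  simp [nbrs]

theorem card_nbrs (S : Finset V) (v : V) : (nbrs G S v).card = degIn G S v := rfl

/-- In a `k`-regular induced subgraph, `k` neighbours of `v` are already all of them. A member
therefore contains a frame iff the frame is its full neighbourhood at the root. -/
theorem subset_iff_nbrs_eq {k : ℕ} {S T : Finset V} {v : V} (hreg : degIn G S v = k)
    (hT : IsFrame G k v T) : T ⊆ S ↔ nbrs G S v = T := by
  refine ⟨fun h => ?_, fun h w hw => ?_⟩
  · refine (Finset.eq_of_subset_of_card_le (fun w hw => mem_nbrs.2 ⟨h hw, hT.2 w hw⟩) ?_).symm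
    rw [card_nbrs, hreg, hT.1]
  · rw [← h] at hw
    exact (mem_nbrs.1 hw).1

theorem insert_subset_iff_nbrs {k : ℕ} {S T : Finset V} {v : V}
    (hreg : ∀ v ∈ S, degIn G S v = k) (hT : IsFrame G k v T) :
    insert v T ⊆ S ↔ v ∈ S ∧ nbrs G S v = T := by
  rw [Finset.insert_subset_iff]
  exact and_congr_right fun hv => subset_iff_nbrs_eq (hreg v hv) hT

theorem isFrame_nbrs {k : ℕ} {S : Finset V} {v : V} (h : degIn G S v = k) :
    IsFrame G k v (nbrs G S v) :=
  ⟨h, fun _ hw => (mem_nbrs.1 hw).2⟩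

/-- The members of a `k`-system at `v` whose frame at `v` is contained in `A` correspond to the
`k`-subsets of `A`. -/
theorem IsKSystem.card_filter {k : ℕ} {𝒮 : Finset (Finset V)} (h : IsKSystem G k 𝒮) (v : V)
    (A : Finset V) (hA : ∀ w ∈ A, G.Adj v w) :
    (𝒮.filter fun S => v ∈ S ∧ nbrs G S v ⊆ A).card = A.card.choose k := by
  rw [← Finset.card_powersetCard]
  refine Finset.card_bij (fun S _ => nbrs G S v) ?_ ?_ ?_
  · intro S hS
    rw [Finset.mem_filter] at hS
    exact Finset.mem_powersetCard.2 ⟨hS.2.2, (h.1 S hS.1).2 v hS.2.1⟩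
  · intro S hS S' hS' hSS
    rw [Finset.mem_filter] at hS hS'
    have hf := isFrame_nbrs ((h.1 S hS.1).2 v hS.2.1)
    exact (h.2 v _ hf).unique
      ⟨hS.1, (insert_subset_iff_nbrs (h.1 S hS.1).2 hf).2 ⟨hS.2.1, rfl⟩⟩
      ⟨hS'.1, (insert_subset_iff_nbrs (h.1 S' hS'.1).2 hf).2 ⟨hS'.2.1, hSS.symm⟩⟩
  · intro T hT
    rw [Finset.mem_powersetCard] at hT
    have hf : IsFrame G k v T := ⟨hT.2, fun w hw => hA w (hT.1 hw)⟩
    obtain ⟨S, ⟨hS, hins⟩, -⟩ := h.2 v T hf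
    obtain ⟨h1, h2⟩ := (insert_subset_iff_nbrs (h.1 S hS).2 hf).1 hins
    exact ⟨S, Finset.mem_filter.2 ⟨hS, h1, h2 ▸ hT.1⟩, h2⟩

theorem IsKSystem.card_filter_mem {k : ℕ} {𝒮 : Finset (Finset V)} (h : IsKSystem G k 𝒮) (v : V) :
    (𝒮.filter fun S => v ∈ S).card = (degIn G Finset.univ v).choose k := by
  rw [← card_nbrs, ← h.card_filter v _ fun w hw => (mem_nbrs.1 hw).2]
  congr 1
  refine Finset.filter_congr fun S _ => ?_
  refine (and_iff_left fun w hw => mem_nbrs.2 ⟨Finset.mem_univ _, (mem_nbrs.1 hw).2⟩).symm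

/-- The sinks of the subgraph induced by `S`. -/
def GraphOrientation.sinks (O : GraphOrientation G) (S : Finset V) : Finset V :=
  S.filter fun v => ∀ w ∈ S, G.Adj v w → O.dir w v

theorem GraphOrientation.mem_sinks {O : GraphOrientation G} {S : Finset V} {v : V} :
    v ∈ O.sinks S ↔ v ∈ S ∧ ∀ w ∈ S, G.Adj v w → O.dir w v := by
  simp [sinks]

/-- Reachability is a strict order by acyclicity, so a finite nonempty set contains a vertex from
which no other vertex of the set can be reached. -/
theorem GraphOrientation.IsAcyclic.sinks_nonempty {O : GraphOrientation G} (hO : O.IsAcyclic)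
    {S : Finset V} (hS : S.Nonempty) : (O.sinks S).Nonempty := by
  have : IsTrans V fun u v => Relation.TransGen O.dir v u := ⟨fun _ _ _ h h' => h'.trans h⟩
  have : Std.Irrefl fun u v => Relation.TransGen O.dir v u := ⟨hO⟩
  obtain ⟨v, hv, hmin⟩ := (Finite.wellFounded_of_trans_of_irrefl
    fun u v => Relation.TransGen O.dir v u).has_min (S : Set V) hS
  refine ⟨v, mem_sinks.2 ⟨hv, fun w hw hadj => ?_⟩⟩
  exact ((O.adj_iff v w).1 hadj).resolve_left fun h => hmin w hw (.single h)

theorem GraphOrientation.H_eq_sum_choose (O : GraphOrientation G) {d : ℕ} (k : ℕ)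
    (hd : ∀ v, degIn G Finset.univ v ≤ d) :
    O.H d k = ∑ v, (O.inDeg v).choose k := by
  have hle : ∀ v ∈ Finset.univ, O.inDeg v ∈ Finset.range (d + 1) := fun v _ => by
    refine Finset.mem_range_succ_iff.2 (le_trans (Finset.card_le_card fun u hu => ?_) (hd v))
    simp only [Finset.mem_filter, Finset.mem_univ, true_and] at hu ⊢
    exact (O.adj_iff v u).2 (.inr hu)
  rw [← Finset.sum_fiberwise_of_maps_to hle]
  refine Finset.sum_congr rfl fun i _ => ?_
  rw [Finset.sum_congr rfl fun v hv => by rw [(Finset.mem_filter.1 hv).2], Finset.sum_const,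
    smul_eq_mul, h]

/-- Double counting of pairs (member, sink): `v` is a sink of `S` iff its frame in `S` consists of
in-neighbours, and each `k`-subset of the in-neighbours is the frame of exactly one member. -/
theorem IsKSystem.sum_card_sinks {k d : ℕ} {𝒮 : Finset (Finset V)} (h : IsKSystem G k 𝒮)
    (O : GraphOrientation G) (hd : ∀ v, degIn G Finset.univ v ≤ d) :
    ∑ S ∈ 𝒮, (O.sinks S).card = O.H d k := by
  rw [O.H_eq_sum_choose k hd]
  have h1 : ∀ v : V, (O.inDeg v).choose k = (𝒮.filter fun S => v ∈ O.sinks S).card := by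
    intro v
    rw [GraphOrientation.inDeg, ← h.card_filter v _ fun w hw =>
      (O.adj_iff v w).2 (.inr (Finset.mem_filter.1 hw).2)]
    congr 1
    refine Finset.filter_congr fun S _ => ?_
    rw [GraphOrientation.mem_sinks]
    refine and_congr_right fun _ => ⟨fun hh w hw hadj => ?_, fun hh w hw => ?_⟩
    · exact (Finset.mem_filter.1 (hh (mem_nbrs.2 ⟨hw, hadj⟩))).2
    · rw [mem_nbrs] at hw
      exact Finset.mem_filter.2 ⟨Finset.mem_univ _, hh w hw.1 hw.2⟩
  simp only [h1]
  have := Finset.sum_card_bipartiteAbove_eq_sum_card_bipartiteBelow (s := 𝒮)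
    (t := (Finset.univ : Finset V)) (fun S v => v ∈ O.sinks S)
  simpa [Finset.bipartiteAbove, Finset.bipartiteBelow] using this

theorem IsKSystem.card_le_H {k d : ℕ} {𝒮 : Finset (Finset V)} (h : IsKSystem G k 𝒮)
    {O : GraphOrientation G} (hO : O.IsAcyclic) (hd : ∀ v, degIn G Finset.univ v ≤ d) :
    𝒮.card ≤ O.H d k := by
  rw [← h.sum_card_sinks O hd, Finset.card_eq_sum_ones]
  exact Finset.sum_le_sum fun S hS => (hO.sinks_nonempty (h.1 S hS).1).card_pos

theorem IsKSystem.card_eq_H_iff {k d : ℕ} {𝒮 : Finset (Finset V)} (h : IsKSystem G k 𝒮)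
    {O : GraphOrientation G} (hO : O.IsAcyclic) (hd : ∀ v, degIn G Finset.univ v ≤ d) :
    O.H d k = 𝒮.card ↔ ∀ S ∈ 𝒮, (O.sinks S).card = 1 := by
  rw [← h.sum_card_sinks O hd, Finset.card_eq_sum_ones, eq_comm, Finset.sum_eq_sum_iff_of_le
    fun S hS => (hO.sinks_nonempty (h.1 S hS).1).card_pos]
  exact forall₂_congr fun _ _ => eq_comm

/-- The orientation that directs each edge to its end with the larger value. -/
def GraphOrientation.ofInjective (G : SimpleGraph V) (f : V → ℝ) (hf : f.Injective) :
    GraphOrientation G where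
  dir u v := G.Adj u v ∧ f u < f v
  adj_iff u v := by
    refine ⟨fun h => ?_, ?_⟩
    · rcases lt_or_gt_of_ne (hf.ne h.ne) with h' | h'
      exacts [.inl ⟨h, h'⟩, .inr ⟨h.symm, h'⟩]
    · rintro (h | h)
      exacts [h.1, h.1.symm]
  asymm _ _ h h' := h.2.not_gt h'.2

theorem GraphOrientation.isAcyclic_of_lt (O : GraphOrientation G) (r : V → V → Prop)
    (hirr : ∀ v, ¬ r v v) (htr : ∀ u v w, r u v → r v w → r u w)
    (hO : ∀ u v, O.dir u v → r u v) : O.IsAcyclic := by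
  intro v hv
  refine hirr v ?_
  suffices ∀ u, Relation.TransGen O.dir v u → r v u from this v hv
  intro u hu
  induction hu with
  | single h => exact hO _ _ h
  | tail _ h ih => exact htr _ _ _ ih (hO _ _ h)

theorem GraphOrientation.isAcyclic_ofInjective (f : V → ℝ) (hf : f.Injective) :
    (GraphOrientation.ofInjective G f hf).IsAcyclic :=
  isAcyclic_of_lt _ (fun u v => f u < f v) (fun _ => lt_irrefl _) (fun _ _ _ => lt_trans)
    fun _ _ h => h.2

/-- Every local maximum of `f` on the subgraph induced by `W` is a global one. -/
def LocalMaxGlobal (G : SimpleGraph V) (f : V → ℝ) (W : Finset V) : Prop :=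
  ∀ v ∈ W, (∀ w ∈ W, G.Adj v w → f w < f v) → ∀ w ∈ W, f w ≤ f v

theorem GraphOrientation.card_sinks_ofInjective {f : V → ℝ} (hf : f.Injective) {W : Finset V}
    (hW : W.Nonempty) (h : LocalMaxGlobal G f W) :
    ((GraphOrientation.ofInjective G f hf).sinks W).card = 1 := by
  refine le_antisymm (Finset.card_le_one.2 fun u hu v hv => hf ?_)
    ((isAcyclic_ofInjective f hf).sinks_nonempty hW).card_pos
  rw [mem_sinks] at hu hv
  exact le_antisymm (h v hv.1 (fun w hw ha => (hv.2 w hw ha).2) u hu.1)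
    (h u hu.1 (fun w hw ha => (hu.2 w hw ha).2) v hv.1)

/-- If `f` has the local-to-global property on `W`, then `W` has no proper `k`-regular part. -/
theorem eq_of_subset_of_regular {k : ℕ} {f : V → ℝ} (hf : f.Injective) {S W : Finset V}
    (hSW : S ⊆ W) (hne : S.Nonempty) (hS : ∀ v ∈ S, degIn G S v = k)
    (hW : ∀ v ∈ W, degIn G W v = k) (h : LocalMaxGlobal G f W) : S = W := by
  have hcl : ∀ v ∈ S, ∀ w ∈ W, G.Adj v w → w ∈ S := by
    intro v hv w hw hadj
    have : nbrs G S v = nbrs G W v := by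
      refine Finset.eq_of_subset_of_card_le
        (fun w hw => mem_nbrs.2 ⟨hSW (mem_nbrs.1 hw).1, (mem_nbrs.1 hw).2⟩) ?_
      rw [card_nbrs, card_nbrs, hS v hv, hW v (hSW hv)]
    exact (mem_nbrs.1 (this ▸ mem_nbrs.2 ⟨hw, hadj⟩ : w ∈ nbrs G S v)).1
  -- A part of `W` without edges to the rest of `W` contains a global maximum of `f` on `W`. Both
  -- `S` and `W \ S` are such parts, but the maximum is unique.
  have key : ∀ A ⊆ W, A.Nonempty → (∀ v ∈ A, ∀ w ∈ W, G.Adj v w → w ∈ A) →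
      ∃ v ∈ A, ∀ w ∈ W, f w ≤ f v := by
    intro A hA hAne hAcl
    obtain ⟨v, hv, hmax⟩ := A.exists_max_image f hAne
    refine ⟨v, hv, h v (hA hv) fun w hw hadj => ?_⟩
    exact lt_of_le_of_ne (hmax w (hAcl v hv w hw hadj)) (hf.ne hadj.ne')
  by_contra hne'
  obtain ⟨v, hv, hvmax⟩ := key S hSW hne hcl
  obtain ⟨w, hw, hwmax⟩ := key (W \ S) Finset.sdiff_subset
    (Finset.sdiff_nonempty.2 fun h' => hne' (hSW.antisymm h')) (fun a ha b hb hadj => by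
      rw [Finset.mem_sdiff] at ha ⊢
      exact ⟨hb, fun hbS => ha.2 (hcl b hbS a ha.1 hadj.symm)⟩)
  rw [Finset.mem_sdiff] at hw
  have := hf (le_antisymm (hvmax w hw.1) (hwmax v (hSW hv)))
  exact hw.2 (this ▸ hv)

/-- A `k`-system whose members can each be made initial by a function with the local-to-global
property is the unique largest `k`-system. -/
theorem IsKSystem.eq_of_card_le {k d : ℕ} {𝒮 𝒱 : Finset (Finset V)}
    (h𝒮 : IsKSystem G k 𝒮) (h𝒱 : IsKSystem G k 𝒱) (hd : ∀ v, degIn G Finset.univ v ≤ d)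
    (hf : ∀ W ∈ 𝒱, ∃ f : V → ℝ, f.Injective ∧ (∀ W' ∈ 𝒱, LocalMaxGlobal G f W') ∧
      ∀ u ∈ W, ∀ v ∉ W, f u < f v) (hcard : 𝒱.card ≤ 𝒮.card) : 𝒮 = 𝒱 := by
  refine (Finset.eq_of_subset_of_card_le (fun W hW => ?_) ?_).symm
  · obtain ⟨f, hinj, hloc, hinit⟩ := hf W hW
    have hac := GraphOrientation.isAcyclic_ofInjective (G := G) f hinj
    have hH := (h𝒱.card_eq_H_iff hac hd).2 fun W' hW' =>
      GraphOrientation.card_sinks_ofInjective hinj (h𝒱.1 W' hW').1 (hloc W' hW')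
    have h1 := (h𝒮.card_eq_H_iff hac hd).1
      (le_antisymm (hH.trans_le hcard) (h𝒮.card_le_H hac hd))
    obtain ⟨v, hv, hmax⟩ := W.exists_max_image f (h𝒱.1 W hW).1
    have hfr := isFrame_nbrs ((h𝒱.1 W hW).2 v hv)
    obtain ⟨S, ⟨hS, hins⟩, -⟩ := h𝒮.2 v _ hfr
    obtain ⟨hvS, hN⟩ := (insert_subset_iff_nbrs (h𝒮.1 S hS).2 hfr).1 hins
    have hvsink : v ∈ (GraphOrientation.ofInjective G f hinj).sinks S := by
      refine GraphOrientation.mem_sinks.2 ⟨hvS, fun w hw hadj => ⟨hadj.symm, ?_⟩⟩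
      have hwN : w ∈ nbrs G W v := hN ▸ mem_nbrs.2 ⟨hw, hadj⟩
      exact lt_of_le_of_ne (hmax w (mem_nbrs.1 hwN).1) (hinj.ne hadj.ne')
    obtain ⟨x, hx, hxmax⟩ := S.exists_max_image f (h𝒮.1 S hS).1
    have hxsink : x ∈ (GraphOrientation.ofInjective G f hinj).sinks S :=
      GraphOrientation.mem_sinks.2 ⟨hx, fun w hw hadj =>
        ⟨hadj.symm, lt_of_le_of_ne (hxmax w hw) (hinj.ne hadj.ne')⟩⟩
    -- The maximum of `f` on `S` is a sink, hence equals the only sink `v`. So `S` lies below a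
    -- vertex of `W`, while everything outside `W` lies above.
    obtain rfl := Finset.card_le_one.1 (h1 S hS).le _ hvsink _ hxsink
    have hSW : S ⊆ W := fun w hw => by
      by_contra hwW
      exact (hinit v hv w hwW).not_ge (hxmax w hw)
    rwa [← eq_of_subset_of_regular hinj hSW (h𝒮.1 S hS).1 (h𝒮.1 S hS).2 (h𝒱.1 W hW).2
      (hloc W hW)]
  -- A function `f` is only available for a member of `𝒱`. If there is none, no `k`-frame exists,
  -- and `𝒮` is empty too.
  · rcases 𝒱.eq_empty_or_nonempty with rfl | ⟨W, hW⟩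
    · rw [Finset.card_empty, Nat.le_zero, Finset.card_eq_zero]
      by_contra hne
      obtain ⟨S, hS⟩ := Finset.nonempty_iff_ne_empty.2 hne
      obtain ⟨v, hv⟩ := (h𝒮.1 S hS).1
      obtain ⟨W, ⟨hW, -⟩, -⟩ := h𝒱.2 v _ (isFrame_nbrs ((h𝒮.1 S hS).2 v hv))
      simp at hW
    · obtain ⟨f, hinj, hloc, -⟩ := hf W hW
      have hac := GraphOrientation.isAcyclic_ofInjective (G := G) f hinj
      have hH := (h𝒱.card_eq_H_iff hac hd).2 fun W' hW' =>
        GraphOrientation.card_sinks_ofInjective hinj (h𝒱.1 W' hW').1 (hloc W' hW')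
      exact hH ▸ h𝒮.card_le_H hac hd

end Combinatorics

/-! ### Convex hulls of finite sets and their exposed points -/

section Convex

/-- Each of the finitely many strict inequalities persists for small `ε`. This serves to break ties
of `g` by means of `h`. -/
theorem exists_pos_perturbation {α : Type*} (s : Finset α) (g h : α → ℝ) :
    ∃ ε : ℝ, 0 < ε ∧ ∀ a ∈ s, ∀ b ∈ s, g a < g b → g a + ε * h a < g b + ε * h b := by
  have hev : ∀ᶠ ε : ℝ in nhdsWithin 0 (Set.Ioi 0), ∀ a ∈ s, ∀ b ∈ s,
      g a < g b → g a + ε * h a < g b + ε * h b := by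
    refine (Filter.eventually_all_finset s).2 fun a _ => (Filter.eventually_all_finset s).2
      fun b _ => ?_
    by_cases hab : g a < g b
    · have h1 : ∀ c : α, Filter.Tendsto (fun ε : ℝ => g c + ε * h c) (nhdsWithin 0 (Set.Ioi 0))
          (nhds (g c)) := fun c => by
        have : Filter.Tendsto (fun ε : ℝ => g c + ε * h c) (nhds 0) (nhds (g c + 0 * h c)) :=
          Continuous.tendsto (by fun_prop) 0
        rw [zero_mul, add_zero] at this
        exact this.mono_left nhdsWithin_le_nhds
      filter_upwards [(h1 a).eventually_lt (h1 b) hab] with ε hε _ using hε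
    · exact Filter.Eventually.of_forall fun _ h => absurd h hab
  obtain ⟨ε, h1, h2⟩ := (hev.and self_mem_nhdsWithin).exists
  exact ⟨ε, h2, h1⟩

variable {E : Type*} [NormedAddCommGroup E] [InnerProductSpace ℝ E]

/-- Every point of a finite set is in the convex hull of those points that are the unique maximum
of a linear function on the set. -/
theorem subset_convexHull_uniquely_exposed (s : Finset E) :
    (s : Set E) ⊆ convexHull ℝ {a | a ∈ s ∧ ∃ l : E →L[ℝ] ℝ, ∀ b ∈ s, b ≠ a → l b < l a} := by
  intro x hx
  by_contra hxK
  have hfin : {a | a ∈ s ∧ ∃ l : E →L[ℝ] ℝ, ∀ b ∈ s, b ≠ a → l b < l a}.Finite :=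
    s.finite_toSet.subset fun a ha => ha.1
  obtain ⟨f, u, hfK, hfx⟩ := geometric_hahn_banach_closed_point (convex_convexHull ℝ _)
    (hfin.isCompact_convexHull ℝ).isClosed hxK
  obtain ⟨y, hy, hymax⟩ := s.exists_max_image f ⟨x, hx⟩
  -- Among the maximizers of `f`, a longest one `a` is singled out by the inner product with `a`. A
  -- small multiple of that, added to `f`, exposes `a` uniquely, so `a` lies in the hull although `f
  -- a ≥ f x`.
  obtain ⟨a, ha, hamax⟩ := (s.filter fun z => f z = f y).exists_max_image (fun z => ‖z‖)
    ⟨y, by simp [hy]⟩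
  rw [Finset.mem_filter] at ha
  obtain ⟨ε, hε, hpert⟩ := exists_pos_perturbation s f fun z => inner ℝ a z
  have haK := hfK a (subset_convexHull ℝ _ ⟨ha.1, f + ε • innerSL ℝ a, fun b hb hba => by
    simp only [add_apply, smul_apply, innerSL_apply_apply,
      smul_eq_mul]
    rcases (hymax b hb).lt_or_eq with h | h
    · exact hpert b hb a ha.1 (by rwa [ha.2])
    · rw [h, ha.2]
      have h1 := hamax b (by simp [hb, h])
      have h2 : 0 < ‖a - b‖ ^ 2 := by
        have := norm_pos_iff.2 (sub_ne_zero.2 hba.symm)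
        positivity
      rw [norm_sub_sq_real] at h2
      have h3 : ‖b‖ ^ 2 ≤ ‖a‖ ^ 2 := by gcongr
      have h4 : inner ℝ a b < inner ℝ a a := by rw [real_inner_self_eq_norm_sq]; linarith
      have := mul_lt_mul_of_pos_left h4 hε
      linarith⟩)
  have := hymax x hx
  rw [← ha.2] at this
  linarith

/-- The points with both properties form a convex set containing `s`: if a proper convex combination
attains the bound `c`, both of its ends do. -/
theorem mem_convexHull_argmax {s : Set E} {l : E →L[ℝ] ℝ} {c : ℝ} (hs : ∀ b ∈ s, l b ≤ c) {x : E}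
    (hx : x ∈ convexHull ℝ s) : l x ≤ c ∧ (l x = c → x ∈ convexHull ℝ {b ∈ s | l b = c}) := by
  suffices h : Convex ℝ {x | l x ≤ c ∧ (l x = c → x ∈ convexHull ℝ {b ∈ s | l b = c})} from
    convexHull_min (t := {x | l x ≤ c ∧ (l x = c → x ∈ convexHull ℝ {b ∈ s | l b = c})})
      (fun b hb => ⟨hs b hb, fun h => subset_convexHull ℝ _ ⟨hb, h⟩⟩) h hx
  refine convex_iff_forall_pos.2 fun y hy z hz a b ha hb hab => ?_
  have h1 : l (a • y + b • z) = a * l y + b * l z := by simp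
  have h2 : c = a * c + b * c := by rw [← add_mul, hab, one_mul]
  have hya := mul_le_mul_of_nonneg_left hy.1 ha.le
  have hzb := mul_le_mul_of_nonneg_left hz.1 hb.le
  refine ⟨by rw [h1]; linarith, fun h => ?_⟩
  rw [h1] at h
  have hy' : l y = c := mul_left_cancel₀ ha.ne' (by linarith)
  have hz' : l z = c := mul_left_cancel₀ hb.ne' (by linarith)
  exact convex_convexHull ℝ _ (hy.2 hy') (hz.2 hz') ha.le hb.le hab

end Convex

/-! ### Faces, edge cones and graphs of polytopes -/

namespace Polytope

variable {m : ℕ} {P : Polytope m}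

theorem Vert.mem_carrier (v : P.Vert) : v.1 ∈ P.carrier :=
  v.2.subset rfl

theorem isExposed_of_le {l : EuclideanSpace ℝ (Fin m) →L[ℝ] ℝ} {c : ℝ}
    (hc : ∀ x ∈ P.carrier, l x ≤ c) {x₀ : EuclideanSpace ℝ (Fin m)} (hx₀ : x₀ ∈ P.carrier)
    (h : l x₀ = c) : IsExposed ℝ P.carrier {x ∈ P.carrier | l x = c} := by
  refine fun _ => ⟨l, Set.ext fun x => ?_⟩
  refine and_congr_right fun hx => ⟨fun hxc y hy => hxc ▸ hc y hy, fun hmax => ?_⟩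
  exact le_antisymm (hc x hx) (h ▸ hmax x₀ hx₀)

/-- The uniquely exposed points of a generating set generate the same hull, and each of them is a
vertex. -/
theorem carrier_eq_convexHull (P : Polytope m) :
    P.carrier = convexHull ℝ (Set.range fun v : P.Vert => v.1) := by
  obtain ⟨T, -, hT⟩ := P.exists_finset
  have hconv : Convex ℝ P.carrier := hT ▸ convex_convexHull ℝ _
  refine Set.Subset.antisymm ?_ (convexHull_min ?_ hconv)
  · conv_lhs => rw [hT]
    refine convexHull_min ((subset_convexHull_uniquely_exposed T).trans (convexHull_mono ?_))
      (convex_convexHull ℝ _)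
    rintro a ⟨ha, l, hl⟩
    refine ⟨⟨a, ?_⟩, rfl⟩
    have hle : ∀ b ∈ (T : Set (EuclideanSpace ℝ (Fin m))), l b ≤ l a := fun b hb => by
      by_cases h : b = a
      exacts [h ▸ le_rfl, (hl b hb h).le]
    have hcar : ∀ x ∈ P.carrier, l x ≤ l a := fun x hx =>
      (mem_convexHull_argmax hle (hT ▸ hx)).1
    have haP : a ∈ P.carrier := hT ▸ subset_convexHull ℝ _ ha
    convert isExposed_of_le hcar haP rfl
    refine Set.Subset.antisymm (by rintro x rfl; exact ⟨haP, rfl⟩) fun x hx => ?_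
    have h1 := (mem_convexHull_argmax hle (hT ▸ hx.1)).2 hx.2
    have h2 : {b ∈ (T : Set (EuclideanSpace ℝ (Fin m))) | l b = l a} ⊆ {a} := fun b hb => by
      by_contra h
      exact (hl b hb.1 h).ne hb.2
    simpa using convexHull_mono h2 h1
  · rintro _ ⟨v, rfl⟩
    exact v.mem_carrier

theorem convex_carrier (P : Polytope m) : Convex ℝ P.carrier := by
  obtain ⟨T, -, hT⟩ := P.exists_finset
  exact hT ▸ convex_convexHull ℝ _

theorem le_on_carrier {l : EuclideanSpace ℝ (Fin m) →L[ℝ] ℝ} {c : ℝ} (h : ∀ v : P.Vert, l v.1 ≤ c)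
    {x : EuclideanSpace ℝ (Fin m)} (hx : x ∈ P.carrier) : l x ≤ c := by
  rw [carrier_eq_convexHull] at hx
  exact (mem_convexHull_argmax (by rintro _ ⟨v, rfl⟩; exact h v) hx).1

theorem mem_convexHull_vert_argmax {l : EuclideanSpace ℝ (Fin m) →L[ℝ] ℝ} {c : ℝ}
    (h : ∀ v : P.Vert, l v.1 ≤ c) {x : EuclideanSpace ℝ (Fin m)} (hx : x ∈ P.carrier)
    (hxc : l x = c) : x ∈ convexHull ℝ {y | ∃ v : P.Vert, v.1 = y ∧ l y = c} := by
  rw [carrier_eq_convexHull] at hx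
  refine convexHull_mono ?_ ((mem_convexHull_argmax (by rintro _ ⟨v, rfl⟩; exact h v) hx).2 hxc)
  rintro _ ⟨⟨v, rfl⟩, hv⟩
  exact ⟨v, rfl, hv⟩

theorem exists_vert_eq {l : EuclideanSpace ℝ (Fin m) →L[ℝ] ℝ} {c : ℝ}
    (h : ∀ v : P.Vert, l v.1 ≤ c) {x : EuclideanSpace ℝ (Fin m)} (hx : x ∈ P.carrier)
    (hxc : l x = c) : ∃ v : P.Vert, l v.1 = c := by
  have := convexHull_nonempty_iff.1 ⟨x, mem_convexHull_vert_argmax h hx hxc⟩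
  obtain ⟨_, v, rfl, hv⟩ := this
  exact ⟨v, hv⟩

theorem nonempty_vert (P : Polytope m) : Nonempty P.Vert := by
  obtain ⟨T, ⟨x, hx⟩, hT⟩ := P.exists_finset
  obtain ⟨v, -⟩ := exists_vert_eq (P := P) (l := 0) (c := 0) (by simp)
    (hT ▸ subset_convexHull ℝ _ hx) (by simp)
  exact ⟨v⟩

theorem Vert.exists_exposing (v : P.Vert) :
    ∃ l : EuclideanSpace ℝ (Fin m) →L[ℝ] ℝ, ∀ w : P.Vert, w ≠ v → l w.1 < l v.1 := by
  obtain ⟨l, hl⟩ := v.2 (Set.singleton_nonempty _)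
  have hv : v.1 ∈ ({v.1} : Set (EuclideanSpace ℝ (Fin m))) := rfl
  refine ⟨l, fun w hw => ?_⟩
  rw [hl] at hv
  refine lt_of_le_of_ne (hv.2 _ w.mem_carrier) fun h => hw ?_
  have : w.1 ∈ ({v.1} : Set (EuclideanSpace ℝ (Fin m))) := by
    rw [hl]
    exact ⟨w.mem_carrier, fun y hy => h ▸ hv.2 y hy⟩
  exact Subtype.ext this

theorem IsFace.exists_functional {k : ℕ} {F : Set (EuclideanSpace ℝ (Fin m))} (h : P.IsFace k F) :
    ∃ (l : EuclideanSpace ℝ (Fin m) →L[ℝ] ℝ) (c : ℝ), (∀ x ∈ P.carrier, l x ≤ c) ∧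
      F = {x ∈ P.carrier | l x = c} := by
  obtain ⟨x₀, hx₀⟩ := h.1
  obtain ⟨l, hl⟩ := h.2.1 h.1
  rw [hl] at hx₀
  refine ⟨l, l x₀, hx₀.2, ?_⟩
  rw [hl]
  ext x
  exact and_congr_right fun hx => ⟨fun hm => le_antisymm (hx₀.2 x hx) (hm x₀ hx₀.1),
    fun he y hy => he ▸ hx₀.2 y hy⟩

/-- A face is the hull of its vertices; here they are only `v` and `u`, so the face is their
segment. -/
theorem adj_of_functional {l : EuclideanSpace ℝ (Fin m) →L[ℝ] ℝ} {v u : P.Vert} (huv : v ≠ u)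
    (hu : l u.1 = l v.1) (hlt : ∀ w : P.Vert, w ≠ v → w ≠ u → l w.1 < l v.1) :
    P.graph.Adj v u := by
  have hle : ∀ w : P.Vert, l w.1 ≤ l v.1 := fun w => by
    by_cases h1 : w = v
    · exact h1 ▸ le_rfl
    by_cases h2 : w = u
    · rw [h2, hu]
    exact (hlt w h1 h2).le
  have heq : segment ℝ v.1 u.1 = {x ∈ P.carrier | l x = l v.1} := by
    refine Set.Subset.antisymm ?_ fun x hx => ?_
    · rintro _ ⟨a, b, ha, hb, hab, rfl⟩
      refine ⟨?_, ?_⟩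
      · exact P.convex_carrier v.mem_carrier u.mem_carrier ha hb hab
      · simp only [map_add, map_smul, smul_eq_mul, hu]
        rw [← add_mul, hab, one_mul]
    · rw [← convexHull_pair]
      refine convexHull_mono ?_ (mem_convexHull_vert_argmax hle hx.1 hx.2)
      rintro _ ⟨w, rfl, hw⟩
      by_contra h
      simp only [Set.mem_insert_iff, Set.mem_singleton_iff, not_or, Subtype.coe_inj] at h
      exact (hlt w h.1 h.2).ne hw
  refine ⟨huv, ⟨v.1, left_mem_segment ℝ _ _⟩, ?_, ?_⟩
  · rw [heq]
    exact isExposed_of_le (fun x hx => le_on_carrier hle hx) v.mem_carrier rfl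
  · rw [vectorSpan_segment]
    exact finrank_span_singleton (sub_ne_zero.2 fun h => huv (Subtype.ext h.symm))

/-- The edge cone: nonnegative combinations of the edge directions at `v`. -/
def edgeCone (v : P.Vert) : Set (EuclideanSpace ℝ (Fin m)) :=
  {y | ∃ c : P.Vert → ℝ, (∀ u, 0 ≤ c u) ∧ (∀ u, ¬ P.graph.Adj v u → c u = 0) ∧
    y = ∑ u, c u • (u.1 - v.1)}

theorem convex_edgeCone (v : P.Vert) : Convex ℝ (edgeCone v) := by
  rintro _ ⟨c, hc, hc', rfl⟩ _ ⟨d, hd, hd', rfl⟩ a b ha hb -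
  refine ⟨fun u => a * c u + b * d u, fun u => ?_, fun u hu => ?_, ?_⟩
  · have := hc u
    have := hd u
    positivity
  · simp [hc' u hu, hd' u hu]
  · simp only [Finset.smul_sum, smul_smul, add_smul, Finset.sum_add_distrib]

theorem smul_mem_edgeCone {v : P.Vert} {t : ℝ} (ht : 0 ≤ t) {y : EuclideanSpace ℝ (Fin m)}
    (hy : y ∈ edgeCone v) : t • y ∈ edgeCone v := by
  obtain ⟨c, hc, hc', rfl⟩ := hy
  refine ⟨fun u => t * c u, fun u => mul_nonneg ht (hc u), fun u hu => ?_, ?_⟩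
  · simp [hc' u hu]
  · simp only [Finset.smul_sum, smul_smul]

theorem sub_mem_edgeCone_of_adj {v u : P.Vert} (h : P.graph.Adj v u) :
    u.1 - v.1 ∈ edgeCone v := by
  refine ⟨Pi.single u 1, fun w => ?_, fun w hw => ?_, ?_⟩
  · by_cases hwu : w = u
    · subst hwu; simp
    · simp [hwu]
  · rw [Pi.single_eq_of_ne]
    rintro rfl
    exact hw h
  · rw [Finset.sum_eq_single u] <;> simp +contextual

/-- Otherwise `w` would lie strictly between `v` and `u`, and a functional exposing `w` could not be
larger at `w` than at both ends. -/
theorem not_collinear_at {v u w : P.Vert} (hw : w ≠ v) {ρ : ℝ} (hρ : 0 < ρ)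
    (h : w.1 - v.1 = ρ • (u.1 - v.1)) (hρ1 : ρ < 1) : False := by
  obtain ⟨l, hl⟩ := w.exists_exposing
  have h1 := hl v hw.symm
  have huw : u ≠ w := by
    rintro rfl
    have h2 : (1 - ρ) • (u.1 - v.1) = 0 := by rw [sub_smul, one_smul, ← h, sub_self]
    rcases smul_eq_zero.1 h2 with h3 | h3
    · linarith
    · exact hw (Subtype.ext (sub_eq_zero.1 h3))
  have h2 := hl u huw
  have h3 := congrArg l h
  simp only [map_sub, map_smul, smul_eq_mul] at h3
  nlinarith

theorem eq_of_same_ray {v u w : P.Vert} (hu : u ≠ v) (hw : w ≠ v) {ρ : ℝ} (hρ : 0 < ρ)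
    (h : w.1 - v.1 = ρ • (u.1 - v.1)) : w = u := by
  rcases lt_trichotomy ρ 1 with h1 | h1 | h1
  · exact (not_collinear_at hw hρ h h1).elim
  · rw [h1, one_smul] at h
    exact Subtype.ext (sub_left_injective h)
  · refine (not_collinear_at (u := w) hu (inv_pos.2 hρ) ?_ (inv_lt_one_of_one_lt₀ h1)).elim
    rw [h, smul_smul, inv_mul_cancel₀ hρ.ne', one_smul]

/-- A polytope is contained in the cone that its edges at a vertex span. -/
theorem sub_mem_edgeCone (v : P.Vert) {x : EuclideanSpace ℝ (Fin m)} (hx : x ∈ P.carrier) :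
    x - v.1 ∈ edgeCone v := by
  obtain ⟨f, hf⟩ := v.exists_exposing
  -- `r w` is the direction from `v` to `w`, scaled to the hyperplane `f = -1`. The hull of these
  -- points is a vertex figure, whose vertices correspond to the edges at `v`.
  set r : P.Vert → EuclideanSpace ℝ (Fin m) := fun w => (f v.1 - f w.1)⁻¹ • (w.1 - v.1) with hr
  set s : Finset (EuclideanSpace ℝ (Fin m)) := (Finset.univ.filter fun w : P.Vert => w ≠ v).image r with hs
  have hpos : ∀ w : P.Vert, w ≠ v → 0 < f v.1 - f w.1 := fun w hw => sub_pos.2 (hf w hw)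
  have hrw : ∀ w : P.Vert, w ≠ v → w.1 - v.1 = (f v.1 - f w.1) • r w := fun w hw => by
    rw [hr, smul_smul, mul_inv_cancel₀ (hpos w hw).ne', one_smul]
  have hexp : {a | a ∈ s ∧ ∃ l : EuclideanSpace ℝ (Fin m) →L[ℝ] ℝ,
      ∀ b ∈ s, b ≠ a → l b < l a} ⊆ edgeCone v := by
    rintro a ⟨has, l, hl⟩
    obtain ⟨u, hu, rfl⟩ := Finset.mem_image.1 has
    have huv : u ≠ v := (Finset.mem_filter.1 hu).2
    refine smul_mem_edgeCone (inv_nonneg.2 (hpos u huv).le) (sub_mem_edgeCone_of_adj ?_)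
    have hL : ∀ w : P.Vert, w ≠ v → l w.1 - l v.1 = (f v.1 - f w.1) * l (r w) := fun w hw => by
      rw [← map_sub, hrw w hw, map_smul, smul_eq_mul]
    -- Relative to `v`, this functional takes at `w` the value `(f v - f w) * (l (r w) - l (r u))`,
    -- which vanishes for `w = u` and is negative at the other vertices `w ≠ v`.
    refine adj_of_functional (l := l + (l (r u)) • f) huv.symm ?_ fun w hw hwu => ?_
    · have := hL u huv
      simp only [add_apply, smul_apply, smul_eq_mul]
      linarith
    · have h1 := hL w hw
      have hne : r w ≠ r u := fun h => hwu <| by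
        refine eq_of_same_ray huv hw (mul_pos (hpos w hw) (inv_pos.2 (hpos u huv))) ?_
        rw [hrw w hw, h, hr, smul_smul]
      have h2 := hl (r w) (Finset.mem_image_of_mem _ (by simp [hw])) hne
      have h3 := mul_lt_mul_of_pos_left h2 (hpos w hw)
      simp only [add_apply, smul_apply, smul_eq_mul]
      linarith
  have hvert : ∀ w : P.Vert, w.1 - v.1 ∈ edgeCone v := by
    intro w
    by_cases hw : w = v
    · rw [hw, sub_self]
      exact ⟨0, by simp, by simp, by simp⟩
    · rw [hrw w hw]
      refine smul_mem_edgeCone (hpos w hw).le ?_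
      exact convexHull_min hexp (convex_edgeCone v) (subset_convexHull_uniquely_exposed s
        (Finset.mem_image_of_mem _ (by simp [hw])))
  have hconv : Convex ℝ {y | y - v.1 ∈ edgeCone v} := by
    have h : {y | y - v.1 ∈ edgeCone v} = (fun x => -v.1 + x) ⁻¹' edgeCone v := by
      ext y
      rw [Set.mem_preimage, neg_add_eq_sub]
      rfl
    exact h ▸ (convex_edgeCone v).translate_preimage_right (-v.1)
  rw [carrier_eq_convexHull] at hx
  exact convexHull_min (by rintro _ ⟨w, rfl⟩; exact hvert w) hconv hx

/-- A face is contained in the cone that its own edges at a vertex span. -/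
theorem face_mem_cone {l : EuclideanSpace ℝ (Fin m) →L[ℝ] ℝ} {v : P.Vert}
    (hl : ∀ x ∈ P.carrier, l x ≤ l v.1) {x : EuclideanSpace ℝ (Fin m)} (hx : x ∈ P.carrier)
    (hxl : l x = l v.1) :
    ∃ c : P.Vert → ℝ, (∀ u, 0 ≤ c u) ∧ (∀ u, ¬ (P.graph.Adj v u ∧ l u.1 = l v.1) → c u = 0) ∧
      x - v.1 = ∑ u, c u • (u.1 - v.1) := by
  obtain ⟨c, hc, hc', hsum⟩ := sub_mem_edgeCone v hx
  refine ⟨c, hc, fun u hu => ?_, hsum⟩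
  by_contra hcu
  have hadj : P.graph.Adj v u := by
    by_contra h
    exact hcu (hc' u h)
  -- All terms are nonpositive, so each vanishes: edges leaving the face have coefficient zero.
  have h0 : ∑ w, c w * (l w.1 - l v.1) = 0 := by
    have h := congrArg l hsum
    simp only [map_sub, map_sum, map_smul, smul_eq_mul, hxl, sub_self] at h
    exact h.symm
  have h1 := (Finset.sum_eq_zero_iff_of_nonpos fun w _ =>
    mul_nonpos_of_nonneg_of_nonpos (hc w) (sub_nonpos.2 (hl _ w.mem_carrier))).1 h0 u
      (Finset.mem_univ u)
  rcases mul_eq_zero.1 h1 with h | h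
  · exact hcu h
  · exact hu ⟨hadj, sub_eq_zero.1 h⟩

/-- The linear span of a face is generated by its edges at a vertex. -/
theorem vectorSpan_face {l : EuclideanSpace ℝ (Fin m) →L[ℝ] ℝ} {v : P.Vert}
    (hl : ∀ x ∈ P.carrier, l x ≤ l v.1) :
    vectorSpan ℝ {x ∈ P.carrier | l x = l v.1} =
      Submodule.span ℝ (Set.range
        fun u : {u : P.Vert // P.graph.Adj v u ∧ l u.1 = l v.1} => u.1.1 - v.1) := by
  rw [vectorSpan_eq_span_vsub_set_right ℝ (p := v.1) (by exact ⟨v.mem_carrier, rfl⟩)]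
  apply le_antisymm
  · rw [Submodule.span_le]
    rintro _ ⟨x, hx, rfl⟩
    obtain ⟨c, -, hc, hsum⟩ := face_mem_cone hl hx.1 hx.2
    simp only [SetLike.mem_coe, vsub_eq_sub]
    rw [hsum]
    refine Submodule.sum_mem _ fun u _ => ?_
    by_cases hu : P.graph.Adj v u ∧ l u.1 = l v.1
    · exact Submodule.smul_mem _ _ (Submodule.subset_span ⟨⟨u, hu⟩, rfl⟩)
    · rw [hc u hu, zero_smul]
      exact Submodule.zero_mem _
  · refine Submodule.span_mono ?_
    rintro _ ⟨u, rfl⟩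
    exact ⟨u.1.1, ⟨u.1.mem_carrier, u.2.2⟩, rfl⟩

/-- The edge directions at `v` span the direction space of `P`, as the face cut out by the zero
functional is `P` itself. Simplicity says that there are only `dim P` of them. -/
theorem IsSimple.linearIndependent (hP : P.IsSimple) (v : P.Vert) :
    LinearIndependent ℝ fun u : {u : P.Vert // P.graph.Adj v u} => u.1.1 - v.1 := by
  rw [linearIndependent_iff_card_le_finrank_span]
  have h := vectorSpan_face (P := P) (l := 0) (v := v) (by simp)
  have h1 : {x ∈ P.carrier | (0 : EuclideanSpace ℝ (Fin m) →L[ℝ] ℝ) x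
      = (0 : EuclideanSpace ℝ (Fin m) →L[ℝ] ℝ) v.1} = P.carrier := by simp
  have h2 : (Set.range fun u : {u : P.Vert // P.graph.Adj v u ∧
      (0 : EuclideanSpace ℝ (Fin m) →L[ℝ] ℝ) u.1 = (0 : EuclideanSpace ℝ (Fin m) →L[ℝ] ℝ) v.1} =>
      u.1.1 - v.1) = Set.range fun u : {u : P.Vert // P.graph.Adj v u} => u.1.1 - v.1 := by
    ext y
    simp
  rw [h1, h2] at h
  rw [Set.finrank, ← h]
  refine le_of_eq (Eq.trans ?_ (hP v))
  rw [Fintype.card_subtype, degIn]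

theorem IsSimple.finrank_face (hP : P.IsSimple) {l : EuclideanSpace ℝ (Fin m) →L[ℝ] ℝ}
    {v : P.Vert} (hl : ∀ x ∈ P.carrier, l x ≤ l v.1) :
    Module.finrank ℝ (vectorSpan ℝ {x ∈ P.carrier | l x = l v.1}) =
      (Finset.univ.filter fun u : P.Vert => P.graph.Adj v u ∧ l u.1 = l v.1).card := by
  rw [vectorSpan_face hl, finrank_span_eq_card, Fintype.card_subtype]
  exact (hP.linearIndependent v).comp
    (fun u : {u : P.Vert // P.graph.Adj v u ∧ l u.1 = l v.1} => ⟨u.1, u.2.1⟩)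
    fun u w h => Subtype.ext (congrArg (fun z => z.1) h)

theorem mem_faceVerts {k : ℕ} {W : Finset P.Vert} :
    W ∈ P.faceVerts k ↔ ∃ F, P.IsFace k F ∧ ∀ v : P.Vert, v ∈ W ↔ v.1 ∈ F := by
  simp [faceVerts]

/-- A linear function describing the face with vertex set `W`. -/
theorem exists_functional_of_mem_faceVerts {k : ℕ} {W : Finset P.Vert} (hW : W ∈ P.faceVerts k) :
    W.Nonempty ∧ ∃ (l : EuclideanSpace ℝ (Fin m) →L[ℝ] ℝ) (c : ℝ),
      (∀ x ∈ P.carrier, l x ≤ c) ∧ (∀ v : P.Vert, v ∈ W ↔ l v.1 = c) ∧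
      Module.finrank ℝ (vectorSpan ℝ {x ∈ P.carrier | l x = c}) = k := by
  obtain ⟨F, hF, hWF⟩ := mem_faceVerts.1 hW
  obtain ⟨l, c, hle, rfl⟩ := hF.exists_functional
  have hiff : ∀ v : P.Vert, v ∈ W ↔ l v.1 = c := fun v => by
    rw [hWF]
    exact and_iff_right v.mem_carrier
  obtain ⟨x, hx⟩ := hF.1
  obtain ⟨v, hv⟩ := exists_vert_eq (fun v => hle _ v.mem_carrier) hx.1 hx.2
  exact ⟨⟨v, (hiff v).2 hv⟩, l, c, hle, hiff, hF.2.2⟩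

theorem IsSimple.degIn_face (hP : P.IsSimple) {k : ℕ} {W : Finset P.Vert}
    (hW : W ∈ P.faceVerts k) {v : P.Vert} (hv : v ∈ W) : degIn P.graph W v = k := by
  obtain ⟨-, l, c, hle, hiff, hk⟩ := exists_functional_of_mem_faceVerts hW
  obtain rfl := (hiff v).1 hv
  rw [← hk, hP.finrank_face hle, degIn]
  congr 1
  ext u
  simp [hiff, and_comm]

/-- By linear independence, a functional can be prescribed as `0` on the edges to `T` and `-1` on
the other edges at `v`. The edge cone shows that it is maximal at `v` over all of `P`, and the face
it cuts out has exactly the edges to `T` at `v`. -/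
theorem IsSimple.exists_face (hP : P.IsSimple) {k : ℕ} {v : P.Vert} {T : Finset P.Vert}
    (hT : IsFrame P.graph k v T) : ∃ W ∈ P.faceVerts k, v ∈ W ∧ T ⊆ W := by
  obtain ⟨g, hg⟩ : ∃ g : EuclideanSpace ℝ (Fin m) →ₗ[ℝ] ℝ,
      ∀ u : {u : P.Vert // P.graph.Adj v u}, g (u.1.1 - v.1) = if u.1 ∈ T then 0 else -1 := by
    have hli := hP.linearIndependent v
    obtain ⟨g, hg⟩ := LinearMap.exists_extend
      ((Module.Basis.span hli).constr ℝ fun u => if u.1 ∈ T then (0 : ℝ) else -1)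
    refine ⟨g, fun u => ?_⟩
    have h1 := congrArg (fun f => f (Module.Basis.span hli u)) hg
    simp only [Module.Basis.constr_basis] at h1
    rw [← h1]
    simp [Module.Basis.span_apply]
  set l : EuclideanSpace ℝ (Fin m) →L[ℝ] ℝ := LinearMap.toContinuousLinearMap g with hl
  have hlu : ∀ u : P.Vert, P.graph.Adj v u → l u.1 = l v.1 + if u ∈ T then 0 else -1 := by
    intro u hu
    have := hg ⟨u, hu⟩
    rw [map_sub] at this
    rw [hl]
    simp only [LinearMap.coe_toContinuousLinearMap']
    linarith
  have hle : ∀ x ∈ P.carrier, l x ≤ l v.1 := by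
    intro x hx
    obtain ⟨c, hc, hc', hsum⟩ := sub_mem_edgeCone v hx
    rw [← sub_nonpos, ← map_sub, hsum, map_sum]
    refine Finset.sum_nonpos fun u _ => ?_
    rw [map_smul, smul_eq_mul]
    by_cases hu : P.graph.Adj v u
    · refine mul_nonpos_of_nonneg_of_nonpos (hc u) ?_
      rw [map_sub, hlu u hu]
      split_ifs <;> simp
    · rw [hc' u hu, zero_mul]
  have hTl : ∀ u : P.Vert, P.graph.Adj v u → (l u.1 = l v.1 ↔ u ∈ T) := fun u hu => by
    rw [hlu u hu]
    split_ifs with h <;> simp [h]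
  refine ⟨Finset.univ.filter fun u : P.Vert => l u.1 = l v.1, mem_faceVerts.2
    ⟨{x ∈ P.carrier | l x = l v.1}, ⟨⟨v.1, v.mem_carrier, rfl⟩,
      isExposed_of_le hle v.mem_carrier rfl, ?_⟩, fun u => ?_⟩, ?_⟩
  · rw [hP.finrank_face hle, ← hT.1]
    congr 1
    ext u
    simp only [Finset.mem_filter, Finset.mem_univ, true_and]
    exact ⟨fun h => (hTl u h.1).1 h.2, fun h => ⟨hT.2 u h, (hTl u (hT.2 u h)).2 h⟩⟩
  · simp only [Finset.mem_filter, Finset.mem_univ, true_and]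
    exact (and_iff_right u.mem_carrier).symm
  · exact ⟨by simp, fun u hu => by simp [(hTl u (hT.2 u hu)).2 hu]⟩

/-- `W` lies in the cone spanned by its edges at `v`, which lead to `T`; the functional defining
`W'` is constant along all of them. -/
theorem IsSimple.face_subset (hP : P.IsSimple) {k : ℕ} {v : P.Vert} {T W W' : Finset P.Vert}
    (hT : IsFrame P.graph k v T) (hW : W ∈ P.faceVerts k) (hW' : W' ∈ P.faceVerts k)
    (hTW : v ∈ W ∧ T ⊆ W) (hTW' : v ∈ W' ∧ T ⊆ W') : W ⊆ W' := by
  have hv := hTW.1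
  have hN := (subset_iff_nbrs_eq (hP.degIn_face hW hv) hT).1 hTW.2
  obtain ⟨-, l, c, hle, hiff, -⟩ := exists_functional_of_mem_faceVerts hW
  obtain ⟨-, l', c', hle', hiff', -⟩ := exists_functional_of_mem_faceVerts hW'
  obtain rfl := (hiff v).1 hv
  obtain rfl := (hiff' v).1 hTW'.1
  intro w hw
  obtain ⟨c, -, hc', hsum⟩ := face_mem_cone hle w.mem_carrier ((hiff w).1 hw)
  rw [hiff', ← sub_eq_zero, ← map_sub, hsum, map_sum]
  refine Finset.sum_eq_zero fun u _ => ?_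
  by_cases hu : P.graph.Adj v u ∧ l u.1 = l v.1
  · have huT : u ∈ T := hN ▸ mem_nbrs.2 ⟨(hiff u).2 hu.2, hu.1⟩
    rw [map_smul, map_sub, (hiff' u).1 (hTW'.2 huT), sub_self, smul_zero]
  · rw [hc' u hu, zero_smul, map_zero]

/-- The `k`-faces of a simple polytope form a `k`-system of its graph. -/
theorem IsSimple.isKSystem_faceVerts (hP : P.IsSimple) (k : ℕ) :
    IsKSystem P.graph k (P.faceVerts k) := by
  refine ⟨fun W hW => ⟨(exists_functional_of_mem_faceVerts hW).1, fun v hv =>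
    hP.degIn_face hW hv⟩, fun v T hT => ?_⟩
  obtain ⟨W, hW, hTW⟩ := hP.exists_face hT
  simp only [Finset.insert_subset_iff]
  exact ⟨W, ⟨hW, hTW⟩, fun W' hW' => (hP.face_subset hT hW'.1 hW hW'.2 hTW).antisymm
    (hP.face_subset hT hW hW'.1 hTW hW'.2)⟩

/-- Linear functions satisfy the local-to-global principle on the graph of every face. -/
theorem localMaxGlobal_face {k : ℕ} {W : Finset P.Vert} (hW : W ∈ P.faceVerts k)
    (f : EuclideanSpace ℝ (Fin m) →L[ℝ] ℝ) :
    LocalMaxGlobal P.graph (fun v => f v.1) W := by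
  intro v hv hloc w hw
  obtain ⟨-, l, c, hle, hiff, -⟩ := exists_functional_of_mem_faceVerts hW
  obtain rfl := (hiff v).1 hv
  obtain ⟨c, hc, hc', hsum⟩ := face_mem_cone hle w.mem_carrier ((hiff w).1 hw)
  simp only
  rw [← sub_nonpos, ← map_sub, hsum, map_sum]
  refine Finset.sum_nonpos fun u _ => ?_
  rw [map_smul, smul_eq_mul]
  by_cases hu : P.graph.Adj v u ∧ l u.1 = l v.1
  · refine mul_nonpos_of_nonneg_of_nonpos (hc u) ?_
    rw [map_sub, sub_nonpos]
    exact (hloc u ((hiff u).2 hu.2) hu.1).le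
  · rw [hc' u hu, zero_mul]

theorem exists_injective_functional (P : Polytope m) :
    ∃ h : EuclideanSpace ℝ (Fin m) →L[ℝ] ℝ, Function.Injective fun v : P.Vert => h v.1 := by
  obtain ⟨h, hh⟩ := Module.exists_dual_forall_apply_ne_zero (K := ℝ)
    (fun p : {p : P.Vert × P.Vert // p.1 ≠ p.2} => p.1.1.1 - p.1.2.1)
    fun p => sub_ne_zero.2 fun h => p.2 (Subtype.ext h)
  refine ⟨LinearMap.toContinuousLinearMap h, fun v w hvw => ?_⟩
  by_contra hne
  refine hh ⟨(v, w), hne⟩ ?_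
  rw [map_sub, sub_eq_zero]
  exact hvw

/-- For each face there is a generic linear function that is smallest on it. -/
theorem exists_injective_initial {k : ℕ} {W : Finset P.Vert} (hW : W ∈ P.faceVerts k) :
    ∃ f : EuclideanSpace ℝ (Fin m) →L[ℝ] ℝ, (Function.Injective fun v : P.Vert => f v.1) ∧
      ∀ u ∈ W, ∀ v ∉ W, f u.1 < f v.1 := by
  obtain ⟨-, l, c, hle, hiff, -⟩ := exists_functional_of_mem_faceVerts hW
  obtain ⟨h, hh⟩ := P.exists_injective_functional
  -- The negative of the functional defining the face is smallest on `W`; a small generic summand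
  -- makes it injective and keeps `W` below the rest.
  obtain ⟨ε, hε, hpert⟩ := exists_pos_perturbation (Finset.univ : Finset P.Vert)
    (fun v => -l v.1) fun v => h v.1
  refine ⟨-l + ε • h, fun v w hvw => ?_, fun u hu v hv => ?_⟩
  · simp only [add_apply, smul_apply, neg_apply, smul_eq_mul] at hvw
    rcases lt_trichotomy (-l v.1) (-l w.1) with h1 | h1 | h1
    · exact absurd hvw (hpert v (Finset.mem_univ _) w (Finset.mem_univ _) h1).ne
    · rw [h1] at hvw
      exact hh (mul_left_cancel₀ hε.ne' (add_left_cancel hvw))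
    · exact absurd hvw (hpert w (Finset.mem_univ _) v (Finset.mem_univ _) h1).ne'
  · have h1 := lt_of_le_of_ne (hle _ v.mem_carrier) fun h => hv ((hiff v).2 h)
    rw [← (hiff u).1 hu] at h1
    exact hpert u (Finset.mem_univ _) v (Finset.mem_univ _) (neg_lt_neg h1)

theorem IsSimple.degIn_le (hP : P.IsSimple) (v : P.Vert) :
    degIn P.graph Finset.univ v ≤ P.dim :=
  (hP v).le

theorem IsSimple.exists_orientation (hP : P.IsSimple) (k : ℕ) :
    ∃ O : GraphOrientation P.graph, O.IsAcyclic ∧ O.H P.dim k = (P.faceVerts k).card := by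
  obtain ⟨f, hf⟩ := P.exists_injective_functional
  have hac := GraphOrientation.isAcyclic_ofInjective (G := P.graph) _ hf
  refine ⟨_, hac, ((hP.isKSystem_faceVerts k).card_eq_H_iff hac hP.degIn_le).2 fun W hW => ?_⟩
  exact GraphOrientation.card_sinks_ofInjective hf (exists_functional_of_mem_faceVerts hW).1
    (localMaxGlobal_face hW f)

theorem IsSimple.card_le_card_faceVerts (hP : P.IsSimple) {k : ℕ} {𝒮 : Finset (Finset P.Vert)}
    (h𝒮 : IsKSystem P.graph k 𝒮) : 𝒮.card ≤ (P.faceVerts k).card := by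
  obtain ⟨O, hO, hH⟩ := hP.exists_orientation k
  exact hH ▸ h𝒮.card_le_H hO hP.degIn_le

theorem IsSimple.eq_faceVerts_of_card_le (hP : P.IsSimple) {k : ℕ}
    {𝒮 : Finset (Finset P.Vert)} (h𝒮 : IsKSystem P.graph k 𝒮)
    (hcard : (P.faceVerts k).card ≤ 𝒮.card) : 𝒮 = P.faceVerts k := by
  refine h𝒮.eq_of_card_le (hP.isKSystem_faceVerts k) hP.degIn_le (fun W hW => ?_) hcard
  obtain ⟨f, hf, hinit⟩ := exists_injective_initial hW
  exact ⟨fun v => f v.1, hf, fun W' hW' => localMaxGlobal_face hW' f, hinit⟩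

/-- The orientation also bounds `V_k(P)`, so `|V_k(P)| ≤ H_k(O) = |𝒮|`, and maximality applies. -/
theorem IsSimple.eq_faceVerts_of_H_eq (hP : P.IsSimple) {k : ℕ}
    {𝒮 : Finset (Finset P.Vert)} (h𝒮 : IsKSystem P.graph k 𝒮) {O : GraphOrientation P.graph}
    (hO : O.IsAcyclic) (hH : O.H P.dim k = 𝒮.card) : 𝒮 = P.faceVerts k :=
  hP.eq_faceVerts_of_card_le h𝒮 (hH ▸ (hP.isKSystem_faceVerts k).card_le_H hO hP.degIn_le)

/-- `V_k(P)` is the unique largest `k`-system. -/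
theorem IsSimple.card_lt_of_ne (hP : P.IsSimple) {k : ℕ} {𝒮 : Finset (Finset P.Vert)}
    (h𝒮 : IsKSystem P.graph k 𝒮) (hne : 𝒮 ≠ P.faceVerts k) :
    𝒮.card < (P.faceVerts k).card := by
  by_contra h
  exact hne (hP.eq_faceVerts_of_card_le h𝒮 (not_lt.1 h))

end Polytope

/-! ### Lists and unary numbers stored as trees -/

namespace Data

/-- The length of the list that a tree stores. -/
def len : Data → ℕ
  | nil => 0
  | cons _ b => b.len + 1

/-- The `i`-th entry of the list that a tree stores (`nil` if there is none). -/
def nth (l : Data) (i : ℕ) : Data := (tail^[i] l).head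

theorem head_cons (a b : Data) : (cons a b).head = a := rfl

theorem tail_cons (a b : Data) : (cons a b).tail = b := rfl

theorem size_head_le (x : Data) : x.head.size ≤ x.size := by
  cases x <;> simp only [head, size] <;> omega

theorem size_tail_le (x : Data) : x.tail.size ≤ x.size := by
  cases x <;> simp only [tail, size] <;> omega

theorem size_iterate_tail_le (x : Data) (i : ℕ) : (tail^[i] x).size ≤ x.size := by
  induction i with
  | zero => exact le_rfl
  | succ i ih => rw [Function.iterate_succ_apply']; exact (size_tail_le _).trans ih

theorem len_le_size (x : Data) : x.len ≤ x.size := by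
  induction x with
  | nil => simp [len]
  | cons a b _ ih => simp only [len, size]; omega

theorem len_tail (x : Data) : x.tail.len = x.len - 1 := by
  cases x <;> simp [tail, len]

theorem len_iterate_tail (x : Data) (i : ℕ) : (tail^[i] x).len = x.len - i := by
  induction i with
  | zero => rfl
  | succ i ih => rw [Function.iterate_succ_apply', len_tail, ih]; omega

theorem len_eq_zero {x : Data} : x.len = 0 ↔ x = nil := by
  cases x <;> simp [len]

theorem iterate_tail_eq_nil {x : Data} {i : ℕ} : tail^[i] x = nil ↔ x.len ≤ i := by
  rw [← len_eq_zero, len_iterate_tail]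
  omega

theorem ofNat_zero : ofNat 0 = nil := rfl

theorem ofNat_succ (n : ℕ) : ofNat (n + 1) = cons nil (ofNat n) := rfl

theorem len_ofNat (n : ℕ) : (ofNat n).len = n := by
  induction n with
  | zero => rfl
  | succ n ih => rw [ofNat_succ, len, ih]

theorem size_ofNat (n : ℕ) : (ofNat n).size = 2 * n + 1 := by
  induction n with
  | zero => rfl
  | succ n ih => rw [ofNat_succ, size, ih, size]; omega

theorem ofNat_ne_nil {n : ℕ} : ofNat n ≠ nil ↔ 0 < n := by
  rw [Ne, ← len_eq_zero, len_ofNat]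
  omega

theorem ofProp_ne_nil {p : Prop} : ofProp p ≠ nil ↔ p := by
  unfold ofProp
  split_ifs with h <;> simp [h]

theorem len_ofList (l : List Data) : (ofList l).len = l.length := by
  induction l with
  | nil => rfl
  | cons a l ih => rw [ofList, len, ih, List.length_cons]

theorem nth_ofList (l : List Data) (i : ℕ) (hi : i < l.length) : (ofList l).nth i = l[i] := by
  induction l generalizing i with
  | nil => simp at hi
  | cons a l ih =>
    cases i with
    | zero => rfl
    | succ i =>
      have := ih i (by simpa using hi)
      rw [nth] at this
      rw [nth, Function.iterate_succ_apply, ofList, tail, this, List.getElem_cons_succ]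

theorem size_ofList_le (l : List Data) (b : ℕ) (hl : ∀ x ∈ l, x.size ≤ b) :
    (ofList l).size ≤ l.length * (b + 1) + 1 := by
  induction l with
  | nil => simp [ofList, size]
  | cons a l ih =>
    have h1 := ih fun x hx => hl x (List.mem_cons_of_mem _ hx)
    have h2 := hl a List.mem_cons_self
    rw [ofList, size, List.length_cons, add_mul]
    omega

theorem size_ofProp_le (p : Prop) : (ofProp p).size ≤ 3 := by
  unfold ofProp
  split_ifs <;> simp [size]

end Data

open Data

/-! ### Functions computable in polynomial time -/

theorem polynomial_eval_mono (q : Polynomial ℕ) {a b : ℕ} (h : a ≤ b) : q.eval a ≤ q.eval b := by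
  simp only [Polynomial.eval_eq_sum, Polynomial.sum]
  gcongr

/-- `f` is computed by a program in polynomial time, with outputs of polynomial size. -/
def IsPolyFun (f : Data → Data) : Prop :=
  ∃ (p : Prog) (q : Polynomial ℕ), ∀ x, ∃ t, Run p x (f x) t ∧ t ≤ q.eval x.size ∧
    (f x).size ≤ q.eval x.size

namespace IsPolyFun

theorem id : IsPolyFun fun x => x :=
  ⟨.skip, Polynomial.X + 1, fun x => ⟨1, .skip x, by simp, by simp⟩⟩

theorem nil : IsPolyFun fun _ => .nil :=
  ⟨.nil, 1, fun x => ⟨1, .nil x, by simp, by simp [size]⟩⟩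

theorem comp {f g : Data → Data} (hf : IsPolyFun f) (hg : IsPolyFun g) :
    IsPolyFun fun x => f (g x) := by
  obtain ⟨p, q, hp⟩ := hf
  obtain ⟨p', q', hp'⟩ := hg
  refine ⟨.seq p' p, q' + q.comp q' + 1, fun x => ?_⟩
  obtain ⟨t', hr', ht', hs'⟩ := hp' x
  obtain ⟨t, hr, ht, hs⟩ := hp (g x)
  have := polynomial_eval_mono q hs'
  refine ⟨_, .seq hr' hr, ?_, ?_⟩ <;>
    simp only [Polynomial.eval_add, Polynomial.eval_comp, Polynomial.eval_one] <;> omega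

theorem head {g : Data → Data} (hg : IsPolyFun g) : IsPolyFun fun x => (g x).head :=
  comp (f := Data.head) ⟨.head, Polynomial.X + 1, fun x => ⟨1, .head x, by simp,
    by simpa using (size_head_le x).trans (Nat.le_succ _)⟩⟩ hg

theorem tail {g : Data → Data} (hg : IsPolyFun g) : IsPolyFun fun x => (g x).tail :=
  comp (f := Data.tail) ⟨.tail, Polynomial.X + 1, fun x => ⟨1, .tail x, by simp,
    by simpa using (size_tail_le x).trans (Nat.le_succ _)⟩⟩ hg

theorem cons {f g : Data → Data} (hf : IsPolyFun f) (hg : IsPolyFun g) :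
    IsPolyFun fun x => .cons (f x) (g x) := by
  obtain ⟨p, q, hp⟩ := hf
  obtain ⟨p', q', hp'⟩ := hg
  refine ⟨.pair p p', q + q' + 1, fun x => ?_⟩
  obtain ⟨t, hr, ht, hs⟩ := hp x
  obtain ⟨t', hr', ht', hs'⟩ := hp' x
  refine ⟨_, .pair hr hr', ?_, ?_⟩ <;>
    simp only [Polynomial.eval_add, Polynomial.eval_one, size] <;> omega

theorem ite {c f g : Data → Data} (hc : IsPolyFun c) (hf : IsPolyFun f) (hg : IsPolyFun g) :
    IsPolyFun fun x => if c x ≠ .nil then f x else g x := by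
  obtain ⟨p₀, q₀, hp₀⟩ := hc
  obtain ⟨p, q, hp⟩ := hf
  obtain ⟨p', q', hp'⟩ := hg
  refine ⟨.ite p₀ p p', q₀ + q + q' + 1, fun x => ?_⟩
  obtain ⟨t₀, hr₀, ht₀, -⟩ := hp₀ x
  obtain ⟨t, hr, ht, hs⟩ := hp x
  obtain ⟨t', hr', ht', hs'⟩ := hp' x
  simp only [Polynomial.eval_add, Polynomial.eval_one]
  rcases hcx : c x with _ | ⟨u, v⟩
  · rw [hcx] at hr₀
    rw [if_neg (by simp)]
    exact ⟨_, .ite_false hr₀ hr', by omega, by omega⟩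
  · rw [hcx] at hr₀
    rw [if_pos (by simp)]
    exact ⟨_, .ite_true hr₀ hr, by omega, by omega⟩

end IsPolyFun

/-- A round costs at most `T` steps for the body plus two for test and loop; the final failing test
costs two. -/
theorem run_loop {p : Prog} {f : Data → Data} {T : ℕ} (n : ℕ) (y : Data)
    (hrun : ∀ i < n, ∃ t ≤ T, Run p (f^[i] y) (f^[i + 1] y) t)
    (hne : ∀ i < n, (f^[i] y).head ≠ .nil) (hnil : (f^[n] y).head = .nil) :
    ∃ t ≤ n * (T + 2) + 2, Run (.loop .head p) y (f^[n] y) t := by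
  induction n generalizing y with
  | zero =>
    have h := Run.head y
    rw [Function.iterate_zero_apply] at hnil
    rw [hnil] at h
    exact ⟨2, by simp, .loop_false h⟩
  | succ n ih =>
    obtain ⟨t, ht, hr⟩ := hrun 0 n.succ_pos
    have h0 := hne 0 n.succ_pos
    rw [Function.iterate_zero_apply] at h0 hr
    obtain ⟨t', ht', hr'⟩ := ih (f y) (fun i hi => by
      simpa only [← Function.iterate_succ_apply] using hrun (i + 1) (by omega))
      (fun i hi => by
        simpa only [← Function.iterate_succ_apply] using hne (i + 1) (by omega))
      (by simpa only [← Function.iterate_succ_apply] using hnil)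
    have h := Run.head y
    rcases hy : y.head with _ | ⟨u, v⟩
    · exact absurd hy h0
    · rw [hy] at h
      refine ⟨_, ?_, .loop_true h hr hr'⟩
      rw [add_mul]
      omega

namespace IsPolyFun

/-- A loop whose states have polynomial size and that ends after polynomially many rounds. -/
theorem iterate {init step : Data → Data} (hinit : IsPolyFun init) (hstep : IsPolyFun step)
    (n : Data → ℕ) (q : Polynomial ℕ) (hn : ∀ x, n x ≤ q.eval x.size)
    (hsize : ∀ x, ∀ i ≤ n x, (step^[i] (init x)).size ≤ q.eval x.size)
    (hne : ∀ x, ∀ i < n x, (step^[i] (init x)).head ≠ .nil)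
    (hnil : ∀ x, (step^[n x] (init x)).head = .nil) :
    IsPolyFun fun x => step^[n x] (init x) := by
  obtain ⟨p₀, q₀, hp₀⟩ := hinit
  obtain ⟨p, q', hp⟩ := hstep
  -- At most `q` rounds act on states of size at most `q`. The `3` pays for the last test and the
  -- sequencing, and the final `q` bounds the output.
  refine ⟨.seq p₀ (.loop .head p), q₀ + q * (q'.comp q + 2) + 3 + q, fun x => ?_⟩
  obtain ⟨t₀, hr₀, ht₀, -⟩ := hp₀ x
  obtain ⟨t, ht, hr⟩ := run_loop (p := p) (f := step) (T := q'.eval (q.eval x.size)) (n x)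
    (init x) (fun i hi => by
      obtain ⟨t, hr, ht, -⟩ := hp (step^[i] (init x))
      refine ⟨t, ht.trans (polynomial_eval_mono _ (hsize x i hi.le)), ?_⟩
      rwa [Function.iterate_succ_apply']) (hne x) (hnil x)
  have h1 := Nat.mul_le_mul_right (q'.eval (q.eval x.size) + 2) (hn x)
  have h2 := hsize x (n x) le_rfl
  have h3 : Polynomial.eval x.size (3 : Polynomial ℕ) = 3 := Polynomial.eval_ofNat _ _
  have h4 : Polynomial.eval x.size (2 : Polynomial ℕ) = 2 := Polynomial.eval_ofNat _ _
  refine ⟨_, .seq hr₀ hr, ?_, ?_⟩ <;>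
    simp only [Polynomial.eval_add, Polynomial.eval_mul, Polynomial.eval_comp, h3, h4] <;> omega

/-- Removes the first entries of two lists. -/
def tailPair (y : Data) : Data := .cons y.head.tail y.tail.tail

theorem iterate_tailPair (u v : Data) (i : ℕ) :
    tailPair^[i] (.cons u v) = .cons (Data.tail^[i] u) (Data.tail^[i] v) := by
  induction i with
  | zero => rfl
  | succ i ih => simp only [Function.iterate_succ_apply', ih, tailPair, head_cons, tail_cons]

/-- The list `a x` acts as a clock. Indexing into lists and comparing unary numbers both reduce to
this loop. -/
theorem iterate_tail {a b : Data → Data} (ha : IsPolyFun a) (hb : IsPolyFun b) :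
    IsPolyFun fun x => Data.tail^[(a x).len] (b x) := by
  obtain ⟨_, q, hq⟩ := cons ha hb
  have hsz : ∀ x, (a x).size + (b x).size + 1 ≤ q.eval x.size := fun x => by
    obtain ⟨t, -, -, h⟩ := hq x
    simpa only [size] using h
  have h := iterate (step := tailPair) (cons ha hb) (cons id.head.tail id.tail.tail)
    (fun x => (a x).len) q
    (fun x => by have := hsz x; have := len_le_size (a x); omega)
    (fun x i _ => by
      have h1 := size_iterate_tail_le (a x) i
      have h2 := size_iterate_tail_le (b x) i
      have := hsz x
      rw [iterate_tailPair, size]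
      omega)
    (fun x i hi => by
      rw [iterate_tailPair, head_cons, Ne, iterate_tail_eq_nil]
      omega)
    (fun x => by rw [iterate_tailPair, head_cons, iterate_tail_eq_nil])
  simpa only [iterate_tailPair, tail_cons] using tail h

end IsPolyFun

/-- The number of `i < n` with `R i`. -/
def countLt (R : ℕ → Prop) (n : ℕ) : ℕ := Nat.count R n

/-- One round of the loop that counts the indices with a property: the state consists of the rest of
the list that bounds the loop, the current index, the number of indices found so far, and the
input. -/
def countStep (φ : Data → Data) (y : Data) : Data :=
  .cons y.head.tail (.cons (.cons .nil y.tail.head)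
    (.cons (if φ (.cons y.tail.head y.tail.tail.tail) ≠ .nil then .cons .nil y.tail.tail.head
      else y.tail.tail.head) y.tail.tail.tail))

theorem iterate_countStep (φ : Data → Data) (u x : Data) (i : ℕ) :
    (countStep φ)^[i] (.cons u (.cons .nil (.cons .nil x))) =
      .cons (Data.tail^[i] u) (.cons (ofNat i)
        (.cons (ofNat (countLt (fun j => φ (.cons (ofNat j) x) ≠ .nil) i)) x)) := by
  induction i with
  | zero => simp [countLt, ofNat_zero]
  | succ i ih =>
    simp only [Function.iterate_succ_apply', ih, countStep, head_cons, tail_cons, ofNat_succ,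
      countLt, Nat.count_succ]
    split_ifs <;> simp [ofNat_succ]

theorem countLt_le (R : ℕ → Prop) (n : ℕ) : countLt R n ≤ n := Nat.count_le _

/-- This loop yields all bounded quantifiers: existence is a positive count, and universal
quantification follows by negation. -/
theorem IsPolyFun.count {φ g : Data → Data} (hφ : IsPolyFun φ) (hg : IsPolyFun g) :
    IsPolyFun fun x => ofNat (countLt (fun j => φ (.cons (ofNat j) x) ≠ .nil) (g x).len) := by
  have hinit := hg.cons (nil.cons (nil.cons id))
  obtain ⟨_, q, hq⟩ := hg.cons (nil.cons (nil.cons id))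
  have hsz : ∀ x, (g x).size + x.size ≤ q.eval x.size := fun x => by
    obtain ⟨t, -, -, h⟩ := hq x
    simp only [size] at h
    omega
  have hstep : IsPolyFun (countStep φ) :=
    .cons id.head.tail (.cons (.cons .nil id.tail.head) (.cons
      (.ite (hφ.comp (.cons id.tail.head id.tail.tail.tail)) (.cons .nil id.tail.tail.head)
        id.tail.tail.head) id.tail.tail.tail))
  -- The two unary counters take at most `4 * (g x).len + 2` nodes, the remaining list and the input
  -- at most `q`, and the three pairs one each.
  have h := iterate hinit hstep (fun x => (g x).len) (5 * q + 5)
    (fun x => by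
      have := hsz x
      have := len_le_size (g x)
      simp only [Polynomial.eval_add, Polynomial.eval_mul, Polynomial.eval_ofNat]
      omega)
    (fun x i hi => by
      have h1 := size_iterate_tail_le (g x) i
      have h2 := countLt_le (fun j => φ (.cons (ofNat j) x) ≠ .nil) i
      have := hsz x
      have := len_le_size (g x)
      rw [iterate_countStep]
      simp only [Polynomial.eval_add, Polynomial.eval_mul, Polynomial.eval_ofNat, size, size_ofNat]
      omega)
    (fun x i hi => by
      rw [iterate_countStep, head_cons, Ne, iterate_tail_eq_nil]
      omega)
    (fun x => by rw [iterate_countStep, head_cons, iterate_tail_eq_nil])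
  simpa only [iterate_countStep, tail_cons, head_cons] using h.tail.tail.head

/-- `N` is computable in polynomial time, with unary output. -/
def IsPolyNat (N : Data → ℕ) : Prop := IsPolyFun fun x => ofNat (N x)

/-- `R` is decidable in polynomial time. -/
def IsPolyDec (R : Data → Prop) : Prop := IsPolyFun fun x => ofProp (R x)

theorem IsPolyFun.ne_nil {g : Data → Data} (hg : IsPolyFun g) :
    IsPolyDec fun x => g x ≠ .nil := by
  unfold IsPolyDec
  convert hg.ite (.cons .nil .nil) .nil using 2 with x
  unfold ofProp
  congr

theorem IsPolyDec.congr {R R' : Data → Prop} (hR : IsPolyDec R) (h : ∀ x, R x ↔ R' x) :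
    IsPolyDec R' := by
  have : R = R' := funext fun x => propext (h x)
  exact this ▸ hR

namespace IsPolyDec

variable {R R' : Data → Prop}

theorem ite_fun (hR : IsPolyDec R) {f g : Data → Data} (hf : IsPolyFun f) (hg : IsPolyFun g) :
    IsPolyFun fun x => if R x then f x else g x := by
  simpa only [ofProp_ne_nil] using IsPolyFun.ite hR hf hg

theorem and (hR : IsPolyDec R) (hR' : IsPolyDec R') : IsPolyDec fun x => R x ∧ R' x := by
  refine (hR.ite_fun hR' .nil).ne_nil.congr fun x => ?_
  split_ifs with h <;> simp [h, ofProp_ne_nil]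

theorem not (hR : IsPolyDec R) : IsPolyDec fun x => ¬ R x := by
  refine (hR.ite_fun .nil (.cons .nil .nil)).ne_nil.congr fun x => ?_
  split_ifs with h <;> simp [h]

theorem or (hR : IsPolyDec R) (hR' : IsPolyDec R') : IsPolyDec fun x => R x ∨ R' x :=
  (hR.not.and hR'.not).not.congr fun x => by tauto

theorem imp (hR : IsPolyDec R) (hR' : IsPolyDec R') : IsPolyDec fun x => R x → R' x :=
  (hR.and hR'.not).not.congr fun x => by tauto

theorem iff (hR : IsPolyDec R) (hR' : IsPolyDec R') : IsPolyDec fun x => (R x ↔ R' x) :=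
  ((hR.imp hR').and (hR'.imp hR)).congr fun x => by tauto

end IsPolyDec

theorem IsPolyNat.len {g : Data → Data} (hg : IsPolyFun g) : IsPolyNat fun x => (g x).len := by
  have h := IsPolyFun.count (φ := fun _ => .cons .nil .nil) (.cons .nil .nil) hg
  have h2 : ∀ n, countLt (fun _ => Data.cons .nil .nil ≠ .nil) n = n := fun n => by
    rw [KSys.countLt, Nat.count_eq_card_filter_range]
    simp
  simpa only [IsPolyNat, h2] using h

theorem IsPolyNat.countLt {N : Data → ℕ} {R : Data → ℕ → Prop} (hN : IsPolyNat N)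
    (hR : IsPolyDec fun y => R y.tail y.head.len) : IsPolyNat fun x => countLt (R x) (N x) := by
  have h := IsPolyFun.count hR hN
  simpa only [IsPolyNat, ofProp_ne_nil, tail_cons, head_cons, len_ofNat] using h

theorem countLt_pos {R : ℕ → Prop} {n : ℕ} : 0 < countLt R n ↔ ∃ i < n, R i := by
  rw [countLt, Nat.count_eq_card_filter_range, Finset.card_pos]
  simp [Finset.Nonempty]

theorem IsPolyDec.existsLt {N : Data → ℕ} {R : Data → ℕ → Prop} (hN : IsPolyNat N)
    (hR : IsPolyDec fun y => R y.tail y.head.len) : IsPolyDec fun x => ∃ i < N x, R x i :=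
  (IsPolyNat.countLt hN hR).ne_nil.congr fun x => by rw [ofNat_ne_nil, countLt_pos]

theorem IsPolyDec.forallLt {N : Data → ℕ} {R : Data → ℕ → Prop} (hN : IsPolyNat N)
    (hR : IsPolyDec fun y => R y.tail y.head.len) : IsPolyDec fun x => ∀ i < N x, R x i :=
  (IsPolyDec.existsLt (R := fun x i => ¬ R x i) hN hR.not).not.congr fun x => by
    push Not
    rfl

/-- Dropping `M x` entries from a list of length `N x` leaves something iff `M x < N x`. -/
theorem IsPolyDec.lt {M N : Data → ℕ} (hM : IsPolyNat M) (hN : IsPolyNat N) :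
    IsPolyDec fun x => M x < N x :=
  (IsPolyFun.iterate_tail hM hN).ne_nil.congr fun x => by
    rw [Ne, iterate_tail_eq_nil, len_ofNat, len_ofNat, not_le]

theorem IsPolyDec.eq {M N : Data → ℕ} (hM : IsPolyNat M) (hN : IsPolyNat N) :
    IsPolyDec fun x => M x = N x :=
  ((IsPolyDec.lt hM hN).not.and (IsPolyDec.lt hN hM).not).congr fun x => by omega

theorem IsPolyFun.nth {N : Data → ℕ} {g : Data → Data} (hg : IsPolyFun g) (hN : IsPolyNat N) :
    IsPolyFun fun x => (g x).nth (N x) := by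
  simpa only [Data.nth, len_ofNat] using (IsPolyFun.iterate_tail hN hg).head

/-- A property that is decidable in polynomial time is accepted by a polynomial-time program. -/
theorem IsPolyDec.exists_prog {R : Data → Prop} (hR : IsPolyDec R) :
    ∃ p : Prog, p.IsPolyTime ∧ ∀ x, p.Accepts x ↔ R x := by
  obtain ⟨p, q, hp⟩ := hR
  refine ⟨p, ⟨q, fun x => ?_⟩, fun x => ?_⟩
  · obtain ⟨t, hr, ht, -⟩ := hp x
    exact ⟨_, t, hr, ht⟩
  · obtain ⟨t, hr, -, -⟩ := hp x
    refine ⟨fun ⟨y, t', hr', hy⟩ => ?_, fun h => ⟨_, t, hr, ofProp_ne_nil.2 h⟩⟩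
    rw [(hr'.unique hr).1] at hy
    exact ofProp_ne_nil.1 hy

/-! ### A local characterization of `k`-systems -/

section Local

variable {V : Type*} [Fintype V]

/-- The sets `S s`, `s < N`, are nonempty and induce `k`-regular subgraphs, differ in their frames
at common vertices, cover all vertices, and their frames at each vertex are closed under the exchange
of a leaf. -/
def IsLocalKSystem (G : SimpleGraph V) (k N : ℕ) (S : ℕ → Finset V) : Prop :=
  (∀ s < N, (∃ v, v ∈ S s) ∧ ∀ v, v ∈ S s → degIn G (S s) v = k) ∧
  (∀ s < N, ∀ t < s, ∀ v, v ∈ S s → v ∈ S t → ∃ w, G.Adj v w ∧ ¬ (w ∈ S s ↔ w ∈ S t)) ∧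
  (∀ v, ∃ s < N, v ∈ S s) ∧
  ∀ s < N, ∀ v, v ∈ S s → ∀ w, G.Adj v w → w ∈ S s → ∀ u, G.Adj v u → ¬ u ∈ S s →
    ∃ t < N, v ∈ S t ∧ ∀ r, G.Adj v r → (r ∈ S t ↔ r = u ∨ (¬ r = w ∧ r ∈ S s))

variable {G : SimpleGraph V} {k N : ℕ} {S : ℕ → Finset V}

theorem IsLocalKSystem.eq_of_nbrs_eq (h : IsLocalKSystem G k N S) {s t : ℕ} (hs : s < N)
    (ht : t < N) {v : V} (hvs : v ∈ S s) (hvt : v ∈ S t)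
    (hN : ∀ w, G.Adj v w → (w ∈ S s ↔ w ∈ S t)) : s = t := by
  rcases lt_trichotomy s t with hst | hst | hst
  · obtain ⟨w, hw, hw'⟩ := h.2.1 t ht s hst v hvt hvs
    exact absurd (hN w hw).symm hw'
  · exact hst
  · obtain ⟨w, hw, hw'⟩ := h.2.1 s hs t hst v hvs hvt
    exact absurd (hN w hw) hw'

/-- Take a member at `v` whose frame meets `T` in as many vertices as possible. If the frame is not
`T`, exchanging a leaf outside `T` for a missing one of `T` gives a member with a larger overlap. -/
theorem IsLocalKSystem.exists_nbrs_eq (h : IsLocalKSystem G k N S) {v : V} {T : Finset V}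
    (hT : IsFrame G k v T) : ∃ s < N, v ∈ S s ∧ nbrs G (S s) v = T := by
  obtain ⟨s₀, hs₀, hv₀⟩ := h.2.2.1 v
  obtain ⟨s, hs, hmax⟩ := ((Finset.range N).filter fun s => v ∈ S s).exists_max_image
    (fun s => (nbrs G (S s) v ∩ T).card) ⟨s₀, by simp [hs₀, hv₀]⟩
  simp only [Finset.mem_filter, Finset.mem_range] at hs hmax
  refine ⟨s, hs.1, hs.2, ?_⟩
  have hcard : (nbrs G (S s) v).card = T.card := by
    rw [card_nbrs, (h.1 s hs.1).2 v hs.2, hT.1]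
  by_contra hne
  have h1 : ¬ T ⊆ nbrs G (S s) v := fun hsub =>
    hne (Finset.eq_of_subset_of_card_le hsub hcard.le).symm
  have h2 : ¬ nbrs G (S s) v ⊆ T := fun hsub =>
    hne (Finset.eq_of_subset_of_card_le hsub hcard.ge)
  obtain ⟨u, huT, hu⟩ := Finset.not_subset.1 h1
  obtain ⟨w, hw, hwT⟩ := Finset.not_subset.1 h2
  rw [mem_nbrs] at hw hu
  have huv := hT.2 u huT
  have huS : u ∉ S s := fun h => hu ⟨h, huv⟩
  obtain ⟨t, ht, hvt, hex⟩ := h.2.2.2 s hs.1 v hs.2 w hw.2 hw.1 u huv huS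
  refine (hmax t ⟨ht, hvt⟩).not_gt (Finset.card_lt_card ?_)
  rw [Finset.ssubset_iff_of_subset]
  · refine ⟨u, ?_, ?_⟩
    · exact Finset.mem_inter.2 ⟨mem_nbrs.2 ⟨(hex u huv).2 (.inl rfl), huv⟩, huT⟩
    · exact fun h => huS (mem_nbrs.1 (Finset.mem_inter.1 h).1).1
  · intro r hr
    rw [Finset.mem_inter, mem_nbrs] at hr ⊢
    refine ⟨⟨(hex r hr.1.2).2 (.inr ⟨?_, hr.1.1⟩), hr.1.2⟩, hr.2⟩
    rintro rfl
    exact hwT hr.2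

theorem IsLocalKSystem.injOn (h : IsLocalKSystem G k N S) :
    Set.InjOn S (Finset.range N : Finset ℕ) := by
  intro s hs t ht hst
  rw [Finset.mem_coe, Finset.mem_range] at hs ht
  obtain ⟨v, hv⟩ := (h.1 s hs).1
  exact h.eq_of_nbrs_eq hs ht hv (hst ▸ hv) fun w _ => by rw [hst]

theorem IsLocalKSystem.isKSystem (h : IsLocalKSystem G k N S) :
    IsKSystem G k ((Finset.range N).image S) := by
  refine ⟨fun A hA => ?_, fun v T hT => ?_⟩
  · obtain ⟨s, hs, rfl⟩ := Finset.mem_image.1 hA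
    exact h.1 s (Finset.mem_range.1 hs)
  · obtain ⟨s, hs, hv, hN⟩ := h.exists_nbrs_eq hT
    refine ⟨S s, ⟨Finset.mem_image_of_mem _ (Finset.mem_range.2 hs),
      (insert_subset_iff_nbrs (h.1 s hs).2 hT).2 ⟨hv, hN⟩⟩, ?_⟩
    rintro _ ⟨hA, hTA⟩
    obtain ⟨t, ht, rfl⟩ := Finset.mem_image.1 hA
    rw [Finset.mem_range] at ht
    obtain ⟨hvt, hNt⟩ := (insert_subset_iff_nbrs (h.1 t ht).2 hT).1 hTA
    refine congrArg S (h.eq_of_nbrs_eq ht hs hvt hv fun w hw => ?_)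
    have h1 : w ∈ nbrs G (S t) v ↔ w ∈ nbrs G (S s) v := by rw [hN, hNt]
    simpa [mem_nbrs, hw] using h1

theorem IsLocalKSystem.exists_isKSystem (h : IsLocalKSystem G k N S) :
    ∃ 𝒮 : Finset (Finset V), IsKSystem G k 𝒮 ∧ 𝒮.card = N :=
  ⟨_, h.isKSystem, by rw [Finset.card_image_of_injOn h.injOn, Finset.card_range]⟩

theorem IsKSystem.eq_of_nbrs_eq {𝒮 : Finset (Finset V)} (h : IsKSystem G k 𝒮) {A B : Finset V}
    (hA : A ∈ 𝒮) (hB : B ∈ 𝒮) {v : V} (hvA : v ∈ A) (hvB : v ∈ B)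
    (hN : nbrs G A v = nbrs G B v) : A = B := by
  have hf := isFrame_nbrs ((h.1 A hA).2 v hvA)
  exact (h.2 v _ hf).unique
    ⟨hA, (insert_subset_iff_nbrs (h.1 A hA).2 hf).2 ⟨hvA, rfl⟩⟩
    ⟨hB, (insert_subset_iff_nbrs (h.1 B hB).2 hf).2 ⟨hvB, hN.symm⟩⟩

theorem IsKSystem.exists_nbrs_eq {𝒮 : Finset (Finset V)} (h : IsKSystem G k 𝒮) {v : V}
    {T : Finset V} (hT : IsFrame G k v T) : ∃ A ∈ 𝒮, v ∈ A ∧ nbrs G A v = T := by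
  obtain ⟨A, ⟨hA, hTA⟩, -⟩ := h.2 v T hT
  exact ⟨A, hA, (insert_subset_iff_nbrs (h.1 A hA).2 hT).1 hTA⟩

/-- An exchanged frame is again a `k`-frame, so some member contains it. The degree bound `hk`
provides a frame at every vertex, hence the covering condition. -/
theorem IsKSystem.isLocalKSystem (hinj : Set.InjOn S (Finset.range N : Finset ℕ))
    (h : IsKSystem G k ((Finset.range N).image S)) (hk : ∀ v, k ≤ degIn G Finset.univ v) :
    IsLocalKSystem G k N S := by
  have hmem : ∀ {s}, s < N → S s ∈ (Finset.range N).image S := fun hs =>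
    Finset.mem_image_of_mem _ (Finset.mem_range.2 hs)
  have hex : ∀ {v T}, IsFrame G k v T → ∃ s < N, v ∈ S s ∧ nbrs G (S s) v = T := by
    intro v T hT
    obtain ⟨A, hA, hh⟩ := h.exists_nbrs_eq hT
    obtain ⟨s, hs, rfl⟩ := Finset.mem_image.1 hA
    exact ⟨s, Finset.mem_range.1 hs, hh⟩
  refine ⟨fun s hs => h.1 _ (hmem hs), fun s hs t hts v hvs hvt => ?_, fun v => ?_,
    fun s hs v hv w hvw hw u hvu hu => ?_⟩
  · by_contra! hcon
    refine hts.ne' (hinj (by simpa using hs) (by simpa using hts.trans hs)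
      (h.eq_of_nbrs_eq (hmem hs) (hmem (hts.trans hs)) hvs hvt ?_))
    ext w
    rw [mem_nbrs, mem_nbrs]
    exact and_congr_left fun hw => hcon w hw
  · obtain ⟨T, hT, hTk⟩ := Finset.exists_subset_card_eq (hk v)
    obtain ⟨s, hs, hv, -⟩ := hex (v := v) (T := T) ⟨hTk, fun w hw => (mem_nbrs.1 (hT hw)).2⟩
    exact ⟨s, hs, hv⟩
  · have hwN : w ∈ nbrs G (S s) v := mem_nbrs.2 ⟨hw, hvw⟩
    have hcard : (nbrs G (S s) v).card = k := (h.1 _ (hmem hs)).2 v hv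
    obtain ⟨t, ht, hvt, hN⟩ := hex (v := v) (T := insert u ((nbrs G (S s) v).erase w)) (by
      refine ⟨?_, fun r hr => ?_⟩
      · rw [Finset.card_insert_of_notMem, Finset.card_erase_add_one hwN, hcard]
        exact fun hh => hu (mem_nbrs.1 (Finset.mem_of_mem_erase hh)).1
      · rcases Finset.mem_insert.1 hr with rfl | hr
        · exact hvu
        · exact (mem_nbrs.1 (Finset.mem_of_mem_erase hr)).2)
    refine ⟨t, ht, hvt, fun r hr => ?_⟩
    have h1 : r ∈ nbrs G (S t) v ↔ r ∈ insert u ((nbrs G (S s) v).erase w) := by rw [hN]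
    simpa [mem_nbrs, hr] using h1

/-- `R` is a strict partial order in which adjacent vertices are comparable, and it orients `G` such
that no set `S s`, `s < N`, has two sinks. -/
def IsUniqueSinkOrder (G : SimpleGraph V) (N : ℕ) (S : ℕ → Finset V) (R : V → V → Prop) : Prop :=
  (∀ u, ¬ R u u) ∧ (∀ u v w, R u v → R v w → R u w) ∧ (∀ u v, G.Adj u v → R u v ∨ R v u) ∧
  ∀ s < N, ∀ u, u ∈ S s → (∀ w, w ∈ S s → G.Adj u w → R w u) →
    ∀ v, v ∈ S s → (∀ w, w ∈ S s → G.Adj v w → R w v) → u = v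

theorem IsUniqueSinkOrder.exists_orientation {R : V → V → Prop}
    (h : IsUniqueSinkOrder G N S R) : ∃ O : GraphOrientation G, O.IsAcyclic ∧
      ∀ s < N, (O.sinks (S s)).card ≤ 1 := by
  refine ⟨⟨fun u v => G.Adj u v ∧ R u v, fun u v => ⟨fun ha => ?_, ?_⟩, fun u v huv hvu =>
    h.1 u (h.2.1 u v u huv.2 hvu.2)⟩, ?_, fun s hs => ?_⟩
  · exact (h.2.2.1 u v ha).imp (fun hr => ⟨ha, hr⟩) fun hr => ⟨ha.symm, hr⟩
  · rintro (ha | ha)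
    exacts [ha.1, ha.1.symm]
  · exact GraphOrientation.isAcyclic_of_lt _ R h.1 h.2.1 fun _ _ hd => hd.2
  · refine Finset.card_le_one.2 fun u hu v hv => ?_
    rw [GraphOrientation.mem_sinks] at hu hv
    exact h.2.2.2 s hs u hu.1 (fun w hw ha => (hu.2 w hw ha).2) v hv.1
      fun w hw ha => (hv.2 w hw ha).2

end Local

/-! ### The verifiers -/

/-- The `i`-th entry of the list is not `nil`. -/
def bit (l : Data) (i : ℕ) : Prop := l.nth i ≠ .nil

/-- The local conditions for a `k`-system, for the graph with adjacency matrix `A` and the list `L`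
of incidence vectors. -/
def kSystemTest (A : Data) (k : ℕ) (L : Data) : Prop :=
  (∀ s < L.len, (∃ v < A.len, bit (L.nth s) v) ∧ ∀ v < A.len, bit (L.nth s) v →
    countLt (fun w => bit (L.nth s) w ∧ bit (A.nth v) w) A.len = k) ∧
  (∀ s < L.len, ∀ t < s, ∀ v < A.len, bit (L.nth s) v → bit (L.nth t) v →
    ∃ w < A.len, bit (A.nth v) w ∧ ¬ (bit (L.nth s) w ↔ bit (L.nth t) w)) ∧
  (∀ v < A.len, ∃ s < L.len, bit (L.nth s) v) ∧
  ∀ s < L.len, ∀ v < A.len, bit (L.nth s) v → ∀ w < A.len, bit (A.nth v) w → bit (L.nth s) w →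
    ∀ u < A.len, bit (A.nth v) u → ¬ bit (L.nth s) u →
      ∃ t < L.len, bit (L.nth t) v ∧ ∀ r < A.len, bit (A.nth v) r →
        (bit (L.nth t) r ↔ r = u ∨ (¬ r = w ∧ bit (L.nth s) r))

/-- The conditions on a strict order given by the matrix `c`, for the graph with adjacency matrix `A`
and the list `L` of incidence vectors. -/
def sinkTest (A L c : Data) : Prop :=
  (∀ u < A.len, ¬ bit (c.nth u) u) ∧
  (∀ u < A.len, ∀ v < A.len, ∀ w < A.len, bit (c.nth u) v → bit (c.nth v) w → bit (c.nth u) w) ∧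
  (∀ u < A.len, ∀ v < A.len, bit (A.nth u) v → bit (c.nth u) v ∨ bit (c.nth v) u) ∧
  ∀ s < L.len, ∀ u < A.len, bit (L.nth s) u →
    (∀ w < A.len, bit (L.nth s) w → bit (A.nth u) w → bit (c.nth w) u) →
      ∀ v < A.len, bit (L.nth s) v →
        (∀ w < A.len, bit (L.nth s) w → bit (A.nth v) w → bit (c.nth w) v) → u = v

theorem IsPolyDec.bit {g : Data → Data} {N : Data → ℕ} (hg : IsPolyFun g) (hN : IsPolyNat N) :
    IsPolyDec fun x => bit (g x) (N x) :=
  (hg.nth hN).ne_nil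

theorem isPolyDec_kSystemTest {A L : Data → Data} {k : Data → ℕ} (hA : IsPolyFun A)
    (hk : IsPolyNat k) (hL : IsPolyFun L) :
    IsPolyDec fun x => kSystemTest (A x) (k x) (L x) := by
  -- Every bounded quantifier puts its index in front of the input, so inside the quantifiers `A`,
  -- `k` and `L` are evaluated at iterated tails of the extended input.
  have hk' : ∀ {g : Data → Data}, IsPolyFun g → IsPolyNat fun x => k (g x) :=
    fun hg => IsPolyFun.comp hk hg
  unfold kSystemTest
  repeat' with_reducible first
    | exact IsPolyFun.id
    | apply IsPolyDec.and
    | apply IsPolyDec.or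
    | apply IsPolyDec.not
    | apply IsPolyDec.iff
    | apply IsPolyDec.forallLt
    | apply IsPolyDec.existsLt
    | apply IsPolyDec.bit
    | apply IsPolyDec.eq
    | apply IsPolyDec.imp
    | apply IsPolyNat.countLt
    | apply IsPolyNat.len
    | apply hk'
    | apply IsPolyFun.nth
    | apply IsPolyFun.head
    | apply IsPolyFun.tail
    | apply hA.comp
    | apply hL.comp

theorem isPolyDec_sinkTest {A L c : Data → Data} (hA : IsPolyFun A) (hL : IsPolyFun L)
    (hc : IsPolyFun c) : IsPolyDec fun x => sinkTest (A x) (L x) (c x) := by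
  unfold sinkTest
  repeat' with_reducible first
    | exact IsPolyFun.id
    | apply IsPolyDec.and
    | apply IsPolyDec.or
    | apply IsPolyDec.not
    | apply IsPolyDec.forallLt
    | apply IsPolyDec.bit
    | apply IsPolyDec.eq
    | apply IsPolyDec.imp
    | apply IsPolyNat.len
    | apply IsPolyFun.nth
    | apply IsPolyFun.head
    | apply IsPolyFun.tail
    | apply hA.comp
    | apply hL.comp
    | apply hc.comp

/-! ### From encoded data to graphs and set families -/

section Translate

variable {V : Type*} [Fintype V] {n : ℕ}

theorem forall_lt_iff (e : Fin n ≃ V) {R : ℕ → Prop} :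
    (∀ i < n, R i) ↔ ∀ v, R (e.symm v) :=
  ⟨fun h v => h _ (e.symm v).2, fun h i hi => by simpa using h (e ⟨i, hi⟩)⟩

theorem exists_lt_iff (e : Fin n ≃ V) {R : ℕ → Prop} :
    (∃ i < n, R i) ↔ ∃ v, R (e.symm v) :=
  ⟨fun ⟨i, hi, h⟩ => ⟨e ⟨i, hi⟩, by simpa using h⟩, fun ⟨v, h⟩ => ⟨_, (e.symm v).2, h⟩⟩

theorem countLt_eq_card (e : Fin n ≃ V) (R : ℕ → Prop) :
    countLt R n = (Finset.univ.filter fun v => R (e.symm v)).card := by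
  rw [countLt, Nat.count_eq_card_filter_range]
  symm
  refine Finset.card_bij (fun v _ => (e.symm v : ℕ)) (fun v hv => ?_) (fun u _ v _ h => ?_)
    fun i hi => ?_
  · simpa using hv
  · exact e.symm.injective (Fin.val_injective h)
  · rw [Finset.mem_filter, Finset.mem_range] at hi
    exact ⟨e ⟨i, hi.1⟩, by simpa using hi.2, by simp⟩

/-- The set with incidence vector `l`. -/
def decodeSet (e : Fin n ≃ V) (l : Data) : Finset V :=
  Finset.univ.filter fun v => bit l (e.symm v)

theorem mem_decodeSet (e : Fin n ≃ V) {l : Data} {v : V} :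
    v ∈ decodeSet e l ↔ bit l (e.symm v) := by
  simp [decodeSet]

/-- `A` is the Boolean matrix of the relation `R`. -/
def IsMatrixOf (e : Fin n ≃ V) (R : V → V → Prop) (A : Data) : Prop :=
  A.len = n ∧ ∀ u v, bit (A.nth (e.symm u)) (e.symm v) ↔ R u v

variable {G : SimpleGraph V} {e : Fin n ≃ V} {A : Data}

/-- Here `L` is an arbitrary tree: `decodeSet` reads any entry as a vertex set, so certificates need
no check of their format. -/
theorem kSystemTest_iff (hA : IsMatrixOf e G.Adj A) (k : ℕ) (L : Data) :
    kSystemTest A k L ↔ IsLocalKSystem G k L.len fun s => decodeSet e (L.nth s) := by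
  have hdeg : ∀ v s, countLt (fun w => bit (L.nth s) w ∧ bit (A.nth (e.symm v)) w) n =
      degIn G (decodeSet e (L.nth s)) v := fun v s => by
    rw [countLt_eq_card e, degIn]
    congr 1
    ext w
    simp [mem_decodeSet, hA.2]
  have hval : ∀ u v : V, (e.symm u : ℕ) = e.symm v ↔ u = v := fun u v => by
    rw [Fin.val_inj, e.symm.injective.eq_iff]
  simp only [kSystemTest, IsLocalKSystem, hA.1, forall_lt_iff e, exists_lt_iff e, hA.2, hdeg,
    hval, mem_decodeSet]

theorem sinkTest_iff (hA : IsMatrixOf e G.Adj A) (L c : Data) :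
    sinkTest A L c ↔ IsUniqueSinkOrder G L.len (fun s => decodeSet e (L.nth s))
      fun u v => bit (c.nth (e.symm u)) (e.symm v) := by
  have hval : ∀ u v : V, (e.symm u : ℕ) = e.symm v ↔ u = v := fun u v => by
    rw [Fin.val_inj, e.symm.injective.eq_iff]
  simp only [sinkTest, IsUniqueSinkOrder, hA.1, forall_lt_iff e, hA.2, hval, mem_decodeSet]

/-- The Boolean vector of a property of vertices. -/
def encodeVector (e : Fin n ≃ V) (R : V → Prop) : Data :=
  .ofList (List.ofFn fun i => .ofProp (R (e i)))

theorem bit_encodeVector (R : V → Prop) (v : V) :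
    bit (encodeVector e R) (e.symm v) ↔ R v := by
  rw [bit, encodeVector, nth_ofList _ _ (by simp), List.getElem_ofFn, ofProp_ne_nil]
  simp

theorem decodeSet_encodeVector (S : Finset V) :
    decodeSet e (encodeVector e fun v => v ∈ S) = S := by
  ext v
  rw [mem_decodeSet, bit_encodeVector]

theorem size_encodeVector_le (R : V → Prop) : (encodeVector e R).size ≤ 4 * n + 1 := by
  refine (size_ofList_le _ 3 fun x hx => ?_).trans (by rw [List.length_ofFn]; omega)
  obtain ⟨i, rfl⟩ := (List.mem_ofFn' _ _).1 hx
  exact size_ofProp_le _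

/-- The Boolean matrix of a relation. -/
def encodeMatrix (e : Fin n ≃ V) (R : V → V → Prop) : Data :=
  .ofList (List.ofFn fun i => encodeVector e (R (e i)))

theorem isMatrixOf_encodeMatrix (R : V → V → Prop) : IsMatrixOf e R (encodeMatrix e R) := by
  refine ⟨by rw [encodeMatrix, len_ofList, List.length_ofFn], fun u v => ?_⟩
  rw [encodeMatrix, nth_ofList _ _ (by simp), List.getElem_ofFn, bit_encodeVector]
  simp

theorem size_encodeMatrix_le (R : V → V → Prop) :
    (encodeMatrix e R).size ≤ n * (4 * n + 2) + 1 := by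
  refine (size_ofList_le _ (4 * n + 1) fun x hx => ?_).trans (by rw [List.length_ofFn])
  obtain ⟨i, rfl⟩ := (List.mem_ofFn' _ _).1 hx
  exact size_encodeVector_le _

/-- The list of incidence vectors. -/
def encodeFamily (e : Fin n ≃ V) (L : List (Finset V)) : Data :=
  .ofList (L.map fun S => encodeVector e fun v => v ∈ S)

theorem len_encodeFamily (L : List (Finset V)) : (encodeFamily e L).len = L.length := by
  rw [encodeFamily, len_ofList, List.length_map]

theorem decodeSet_nth_encodeFamily (L : List (Finset V)) {s : ℕ} (hs : s < L.length) :
    decodeSet e ((encodeFamily e L).nth s) = L[s] := by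
  rw [encodeFamily, nth_ofList _ _ (by simpa using hs), List.getElem_map, decodeSet_encodeVector]

theorem size_encodeFamily_le (L : List (Finset V)) :
    (encodeFamily e L).size ≤ L.length * (4 * n + 2) + 1 := by
  refine (size_ofList_le _ (4 * n + 1) fun x hx => ?_).trans (by rw [List.length_map])
  obtain ⟨S, -, rfl⟩ := List.mem_map.1 hx
  exact size_encodeVector_le _

theorem encode_eq (e : Fin n ≃ V) (G : SimpleGraph V) (k : ℕ) (L : List (Finset V)) :
    encode e G k L = .cons (encodeMatrix e G.Adj) (.cons (.ofNat k) (encodeFamily e L)) := rfl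

theorem isLocalKSystem_encodeFamily_iff {k : ℕ} (hk : ∀ v, k ≤ degIn G Finset.univ v)
    {L : List (Finset V)} (hL : L.Nodup) {𝒮 : Finset (Finset V)} (h𝒮 : ∀ S, S ∈ L ↔ S ∈ 𝒮) :
    IsLocalKSystem G k (encodeFamily e L).len
      (fun s => decodeSet e ((encodeFamily e L).nth s)) ↔ IsKSystem G k 𝒮 := by
  have himg : (Finset.range (encodeFamily e L).len).image
      (fun s => decodeSet e ((encodeFamily e L).nth s)) = 𝒮 := by
    ext S
    rw [Finset.mem_image, ← h𝒮, List.mem_iff_getElem]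
    constructor
    · rintro ⟨s, hs, rfl⟩
      rw [Finset.mem_range, len_encodeFamily] at hs
      exact ⟨s, hs, (decodeSet_nth_encodeFamily L hs).symm⟩
    · rintro ⟨s, hs, rfl⟩
      exact ⟨s, by simpa [len_encodeFamily] using hs, decodeSet_nth_encodeFamily L hs⟩
  have hinj : Set.InjOn (fun s => decodeSet e ((encodeFamily e L).nth s))
      (Finset.range (encodeFamily e L).len : Finset ℕ) := by
    intro s hs t ht hst
    rw [Finset.mem_coe, Finset.mem_range, len_encodeFamily] at hs ht
    simp only at hst
    rw [decodeSet_nth_encodeFamily L hs, decodeSet_nth_encodeFamily L ht] at hst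
    exact (hL.getElem_inj_iff).1 hst
  exact ⟨fun h => himg ▸ h.isKSystem, fun h => IsKSystem.isLocalKSystem hinj (himg ▸ h) hk⟩

theorem size_le_encode (e : Fin n ≃ V) (G : SimpleGraph V) (k : ℕ) (L : List (Finset V)) :
    n ≤ (encode e G k L).size ∧ L.length ≤ (encode e G k L).size := by
  have h1 := len_le_size (encodeMatrix e G.Adj)
  have h2 := len_le_size (encodeFamily e L)
  rw [(isMatrixOf_encodeMatrix G.Adj).1] at h1
  rw [len_encodeFamily] at h2
  simp only [encode_eq, size]
  omega

end Translate

/-! ### Size bounds for `k`-systems -/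

namespace IsKSystem

variable {V : Type*} [Fintype V] {G : SimpleGraph V} {k d : ℕ}

/-- Members are nonempty, and every vertex lies in exactly `d.choose k` of them. With the lower
bound `choose_le_card`, this controls the size of one `k`-system by that of another. -/
theorem card_le_card_mul_choose {𝒮 : Finset (Finset V)} (h : IsKSystem G k 𝒮)
    (hd : ∀ v, degIn G Finset.univ v = d) : 𝒮.card ≤ Fintype.card V * d.choose k := by
  have h1 : 𝒮 ⊆ Finset.univ.biUnion fun v => 𝒮.filter fun S => v ∈ S := fun S hS => by
    obtain ⟨v, hv⟩ := (h.1 S hS).1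
    simp only [Finset.mem_biUnion, Finset.mem_filter]
    exact ⟨v, Finset.mem_univ _, hS, hv⟩
  refine (Finset.card_le_card h1).trans (Finset.card_biUnion_le_card_mul _ _ _ fun v _ => ?_)
  rw [h.card_filter_mem, hd]

theorem choose_le_card {𝒮 : Finset (Finset V)} (h : IsKSystem G k 𝒮)
    (hd : ∀ v, degIn G Finset.univ v = d) (v : V) : d.choose k ≤ 𝒮.card := by
  rw [← hd v, ← h.card_filter_mem v]
  exact Finset.card_filter_le _ _

end IsKSystem

/-- The property that the verifier for `𝒮 = V_k(P)` decides; the input consists of the instance and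
the certificate. -/
def yesTest (x : Data) : Prop :=
  kSystemTest x.head.head x.head.tail.head.len x.head.tail.tail ∧
    sinkTest x.head.head x.head.tail.tail x.tail

/-- The property that the verifier for `𝒮 ≠ V_k(P)` decides. -/
def noTest (x : Data) : Prop :=
  ¬ kSystemTest x.head.head x.head.tail.head.len x.head.tail.tail ∨
    (x.head.tail.tail.len < x.tail.len ∧
      kSystemTest x.head.head x.head.tail.head.len x.tail)

theorem isPolyDec_yesTest : IsPolyDec yesTest :=
  (isPolyDec_kSystemTest IsPolyFun.id.head.head (.len IsPolyFun.id.head.tail.head)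
    IsPolyFun.id.head.tail.tail).and
  (isPolyDec_sinkTest IsPolyFun.id.head.head IsPolyFun.id.head.tail.tail IsPolyFun.id.tail)

theorem isPolyDec_noTest : IsPolyDec noTest :=
  (isPolyDec_kSystemTest IsPolyFun.id.head.head (.len IsPolyFun.id.head.tail.head)
    IsPolyFun.id.head.tail.tail).not.or
  ((IsPolyDec.lt (.len IsPolyFun.id.head.tail.tail) (.len IsPolyFun.id.tail)).and
    (isPolyDec_kSystemTest IsPolyFun.id.head.head (.len IsPolyFun.id.head.tail.head)
      IsPolyFun.id.tail))

/-! ### Soundness and completeness of the two verifiers -/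

section Verify

variable {m k n : ℕ} {P : Polytope m} {e : Fin n ≃ P.Vert} {𝒮 : Finset (Finset P.Vert)}
  {L : List (Finset P.Vert)}

theorem kSystemTest_encodeFamily_iff (hP : P.IsSimple) (hk : k ≤ P.dim) (hL : L.Nodup)
    (h𝒮 : ∀ S, S ∈ L ↔ S ∈ 𝒮) :
    kSystemTest (encodeMatrix e P.graph.Adj) k (encodeFamily e L) ↔
      IsKSystem P.graph k 𝒮 := by
  rw [kSystemTest_iff (isMatrixOf_encodeMatrix P.graph.Adj)]
  exact isLocalKSystem_encodeFamily_iff (fun v => hk.trans (hP v).ge) hL h𝒮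

/-- The order in the certificate induces an acyclic orientation with at most one sink in each
member. Acyclicity gives at least one, so `H_k(O) = |𝒮|`. -/
theorem eq_faceVerts_of_yesTest (hP : P.IsSimple) (hk : k ≤ P.dim) (hL : L.Nodup)
    (h𝒮 : ∀ S, S ∈ L ↔ S ∈ 𝒮) {c : Data} (h : yesTest (.cons (encode e P.graph k L) c)) :
    𝒮 = P.faceVerts k := by
  simp only [yesTest, encode_eq, head_cons, tail_cons, len_ofNat] at h
  rw [kSystemTest_encodeFamily_iff hP hk hL h𝒮,
    sinkTest_iff (isMatrixOf_encodeMatrix P.graph.Adj)] at h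
  obtain ⟨O, hO, hsink⟩ := h.2.exists_orientation
  refine hP.eq_faceVerts_of_H_eq h.1 hO ((h.1.card_eq_H_iff hO hP.degIn_le).2 fun S hS => ?_)
  refine le_antisymm ?_ (hO.sinks_nonempty (h.1.1 S hS).1).card_pos
  obtain ⟨s, hs, rfl⟩ := List.mem_iff_getElem.1 ((h𝒮 S).2 hS)
  have := hsink s (by rwa [len_encodeFamily])
  rwa [decodeSet_nth_encodeFamily L hs] at this

theorem exists_yesTest (hP : P.IsSimple) (hk : k ≤ P.dim) (hL : L.Nodup)
    (h𝒮 : ∀ S, S ∈ L ↔ S ∈ 𝒮) (h : 𝒮 = P.faceVerts k) :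
    ∃ c : Data, c.size ≤ n * (4 * n + 2) + 1 ∧ yesTest (.cons (encode e P.graph k L) c) := by
  obtain ⟨f, hf⟩ := P.exists_injective_functional
  -- The certificate is the comparison matrix of a generic linear function; each face has only one
  -- sink since local maxima are global.
  refine ⟨encodeMatrix e fun u v : P.Vert => f u.1 < f v.1, size_encodeMatrix_le _, ?_⟩
  simp only [yesTest, encode_eq, head_cons, tail_cons, len_ofNat]
  rw [kSystemTest_encodeFamily_iff hP hk hL h𝒮,
    sinkTest_iff (isMatrixOf_encodeMatrix P.graph.Adj)]
  refine ⟨h ▸ hP.isKSystem_faceVerts k, ?_⟩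
  simp only [IsUniqueSinkOrder, (isMatrixOf_encodeMatrix _).2, len_encodeFamily]
  refine ⟨fun _ => lt_irrefl _, fun _ _ _ => lt_trans, fun u v ha => lt_or_gt_of_ne (hf.ne ha.ne),
    fun s hs u hu hu' v hv hv' => ?_⟩
  rw [decodeSet_nth_encodeFamily L hs] at hu hu' hv hv'
  have hW : L[s] ∈ P.faceVerts k := h ▸ (h𝒮 _).1 (List.getElem_mem hs)
  exact hf (le_antisymm (Polytope.localMaxGlobal_face hW f v hv hv' u hu)
    (Polytope.localMaxGlobal_face hW f u hu hu' v hv))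

/-- An accepted certificate decodes to a `k`-system with more members than `𝒮`, impossible if `𝒮` is
the largest one. -/
theorem ne_faceVerts_of_noTest (hP : P.IsSimple) (hk : k ≤ P.dim) (hL : L.Nodup)
    (h𝒮 : ∀ S, S ∈ L ↔ S ∈ 𝒮) {c : Data} (h : noTest (.cons (encode e P.graph k L) c)) :
    𝒮 ≠ P.faceVerts k := by
  simp only [noTest, encode_eq, head_cons, tail_cons, len_ofNat] at h
  rw [kSystemTest_encodeFamily_iff hP hk hL h𝒮,
    kSystemTest_iff (isMatrixOf_encodeMatrix P.graph.Adj), len_encodeFamily] at h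
  rintro rfl
  rcases h with h | ⟨hlt, h⟩
  · exact h (hP.isKSystem_faceVerts k)
  · obtain ⟨𝒮', h𝒮', hcard⟩ := h.exists_isKSystem
    have h1 := hP.card_le_card_faceVerts h𝒮'
    have h2 : L.toFinset = P.faceVerts k := by ext S; simp [h𝒮]
    rw [← h2, List.toFinset_card_of_nodup hL] at h1
    omega

/-- The minimum in the bound serves two purposes: `L.length` is polynomial in the input size, while
`P.dim.choose k` is bounded by `n` if `k = P.dim - 1`. -/
theorem exists_noTest (hP : P.IsSimple) (hk : k ≤ P.dim) (hL : L.Nodup)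
    (h𝒮 : ∀ S, S ∈ L ↔ S ∈ 𝒮) (h : 𝒮 ≠ P.faceVerts k) :
    ∃ c : Data, c.size ≤ n * min (P.dim.choose k) L.length * (4 * n + 2) + 1 ∧
      noTest (.cons (encode e P.graph k L) c) := by
  simp only [noTest, encode_eq, head_cons, tail_cons, len_ofNat]
  rw [kSystemTest_encodeFamily_iff hP hk hL h𝒮]
  by_cases hsys : IsKSystem P.graph k 𝒮
  · refine ⟨encodeFamily e (P.faceVerts k).toList, (size_encodeFamily_le _).trans ?_, .inr ⟨?_, ?_⟩⟩
    · have h1 := (hP.isKSystem_faceVerts k).card_le_card_mul_choose hP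
      have h2 : L.toFinset = 𝒮 := by ext S; simp [h𝒮]
      have h3 : Fintype.card P.Vert = n := by
        rw [← Fintype.card_congr e, Fintype.card_fin]
      obtain ⟨v⟩ := P.nonempty_vert
      have h4 := hsys.choose_le_card hP v
      rw [← h2, List.toFinset_card_of_nodup hL] at h4
      rw [min_eq_left h4, Finset.length_toList, ← h3]
      gcongr
    · have h1 := hP.card_lt_of_ne hsys h
      have h2 : L.toFinset = 𝒮 := by ext S; simp [h𝒮]
      rw [← h2, List.toFinset_card_of_nodup hL] at h1
      rwa [len_encodeFamily, len_encodeFamily, Finset.length_toList]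
    · rw [kSystemTest_encodeFamily_iff hP hk (Finset.nodup_toList _)
        fun S => Finset.mem_toList]
      exact hP.isKSystem_faceVerts k
  -- If `𝒮` is not a `k`-system, the verifier detects this from the input alone.
  · exact ⟨.nil, by simp [size], .inl hsys⟩

theorem dim_lt_card (hP : P.IsSimple) : P.dim < Fintype.card P.Vert := by
  obtain ⟨v⟩ := P.nonempty_vert
  rw [← hP v]
  refine Finset.card_lt_univ_of_notMem (x := v) ?_
  simp

end Verify

end KSys

end

theorem mainTheorem5 :
    (∀ (m k : ℕ) (P : KSys.Polytope m), P.IsSimple → 2 ≤ k → k ≤ P.dim - 1 →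
      ∀ 𝒮 : Finset (Finset P.Vert), KSys.IsKSystem P.graph k 𝒮 →
        ((∃ O : KSys.GraphOrientation P.graph, O.IsAcyclic ∧ O.H P.dim k = 𝒮.card) ∨
          (∃ 𝒮' : Finset (Finset P.Vert), KSys.IsKSystem P.graph k 𝒮' ∧ 𝒮.card < 𝒮'.card)) ∧
        ((∃ O : KSys.GraphOrientation P.graph, O.IsAcyclic ∧ O.H P.dim k = 𝒮.card) →
          𝒮 = P.faceVerts k) ∧
        ((∃ 𝒮' : Finset (Finset P.Vert), KSys.IsKSystem P.graph k 𝒮' ∧ 𝒮.card < 𝒮'.card) →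
          𝒮 ≠ P.faceVerts k)) ∧
    (∃ (pYes pNo : KSys.Prog) (f : Polynomial ℕ), pYes.IsPolyTime ∧ pNo.IsPolyTime ∧
      ∀ (m k : ℕ) (P : KSys.Polytope m), P.IsSimple → 2 ≤ k → k ≤ P.dim - 1 →
        ∀ (n : ℕ) (e : Fin n ≃ P.Vert) (𝒮 : Finset (Finset P.Vert)) (L : List (Finset P.Vert)),
          L.Nodup → (∀ S, S ∈ L ↔ S ∈ 𝒮) →
            let x := KSys.encode e P.graph k L
            pYes.Certifies (f.eval n) x (𝒮 = P.faceVerts k) ∧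
            pNo.Certifies (f.eval x.size) x (𝒮 ≠ P.faceVerts k) ∧
            (k = P.dim - 1 → pNo.Certifies (f.eval n) x (𝒮 ≠ P.faceVerts k))) := by
  refine ⟨fun m k P hP _ _ 𝒮 h𝒮 => ⟨?_, ?_, ?_⟩, ?_⟩
  · by_cases h : 𝒮 = P.faceVerts k
    · obtain ⟨O, hO, hH⟩ := hP.exists_orientation k
      exact .inl ⟨O, hO, h ▸ hH⟩
    · exact .inr ⟨_, hP.isKSystem_faceVerts k, hP.card_lt_of_ne h𝒮 h⟩
  · rintro ⟨O, hO, hH⟩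
    exact hP.eq_faceVerts_of_H_eq h𝒮 hO hH
  · rintro ⟨𝒮', h𝒮', hlt⟩ rfl
    exact hlt.not_ge (hP.card_le_card_faceVerts h𝒮')
  obtain ⟨pYes, hYes, hYes'⟩ := KSys.isPolyDec_yesTest.exists_prog
  obtain ⟨pNo, hNo, hNo'⟩ := KSys.isPolyDec_noTest.exists_prog
  refine ⟨pYes, pNo, Polynomial.X * Polynomial.X * (4 * Polynomial.X + 2) +
    Polynomial.X * (4 * Polynomial.X + 2) + 1, hYes, hNo, ?_⟩
  intro m k P hP _ hkd n e 𝒮 L hL h𝒮 x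
  have hk : k ≤ P.dim := hkd.trans (Nat.sub_le _ _)
  simp only [KSys.Prog.Certifies, hYes', hNo', Polynomial.eval_add, Polynomial.eval_mul,
    Polynomial.eval_X, Polynomial.eval_ofNat, Polynomial.eval_one]
  refine ⟨⟨fun h => ?_, fun c => KSys.eq_faceVerts_of_yesTest hP hk hL h𝒮⟩, ⟨fun h => ?_,
    fun c => KSys.ne_faceVerts_of_noTest hP hk hL h𝒮⟩, fun hkd' => ⟨fun h => ?_,
    fun c => KSys.ne_faceVerts_of_noTest hP hk hL h𝒮⟩⟩
  · obtain ⟨c, hc, hc'⟩ := KSys.exists_yesTest (e := e) hP hk hL h𝒮 h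
    exact ⟨c, by omega, hc'⟩
  · obtain ⟨c, hc, hc'⟩ := KSys.exists_noTest (e := e) hP hk hL h𝒮 h
    obtain ⟨hn, hlen⟩ := KSys.size_le_encode e P.graph k L
    refine ⟨c, hc.trans ?_, hc'⟩
    have h1 : n * min (P.dim.choose k) L.length * (4 * n + 2) ≤
        x.size * x.size * (4 * x.size + 2) := by
      gcongr
      exact (min_le_right _ _).trans hlen
    omega
  · obtain ⟨c, hc, hc'⟩ := KSys.exists_noTest (e := e) hP hk hL h𝒮 h
    refine ⟨c, hc.trans ?_, hc'⟩
    -- For `k = d - 1` the binomial coefficient is `d`, and a vertex has `d` neighbours, so `d < n`.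
    have hdim : P.dim.choose k ≤ n := by
      rw [hkd', Nat.choose_symm (by omega), Nat.choose_one_right]
      have := KSys.dim_lt_card hP
      rw [← Fintype.card_congr e, Fintype.card_fin] at this
      exact this.le
    have h1 : n * min (P.dim.choose k) L.length * (4 * n + 2) ≤ n * n * (4 * n + 2) := by
      gcongr
      exact (min_le_left _ _).trans hdim
    omega
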